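/- Let $G$ be a connected (finite-dimensional, real) Lie group with identity $e$ and Lie algebra $\mathfrak g$, and let $\varphi=\{\varphi_t\}_{t\in\mathbb R}$ be a flow of automorphisms of $G$, i.e. a (smooth) one-parameter subgroup of $\mathrm{Aut}(G)$. Let $\mathcal D$ be the derivation of $\mathfrak g$ with $(d\varphi_t)_e=e^{t\mathcal D}$ for all $t\in\mathbb R$, and let $\mathcal D=\mathcal D_{\mathcal H}+\mathcal D_{\mathcal E}+\mathcal D_{\mathcal N}$ be its Jordan decomposition: the summands commute, $\mathcal D_{\mathcal H}$ is semisimple with real eigenvalues, $\mathcal D_{\mathcal E}$ is semisimple with purely imaginary (possibly zero) complex eigenvalues, and $\mathcal D_{\mathcal N}$ is nilpotent. Let $\varphi_t=\varphi^{\mathcal H}_t\circ\varphi^{\mathcal E}_t\circ\varphi^{\mathcal N}_t$ be the corresponding decomposition of $\varphi$ into commuting flows of automorphisms with associated derivations $\mathcal D_{\mathcal H},\mathcal D_{\mathcal E},\mathcal D_{\mathcal N}$. Let $\mathfrak g^{+}$ (resp. $\mathfrak g^{-}$) be the sum of the eigenspaces of $\mathcal D_{\mathcal H}$ for its positive (resp.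 negative) eigenvalues, let $G^{\pm}$ be the connected subgroup of $G$ with Lie algebra $\mathfrak g^{\pm}$, i.e. the subgroup generated by $\exp(\mathfrak g^{\pm})$, let $G^0=\{g\in G:\varphi^{\mathcal H}_t(g)=g\ \text{for all } t\in\mathbb R\}$, and put $G^{+,0}=G^+G^0$. The subgroup $G^0$ is $\varphi$-invariant. For a flow $\psi$ of automorphisms of a topological group $K$ with identity $e$, a neighborhood $U$ of $e$ and $\tau>0$, a $(U,\tau)$-chain from $x$ to $y$ consists of an integer $n\ge 1$, points $x_0=x,x_1,\dots,x_n=y$ in $K$ and times $\tau_0,\dots,\tau_{n-1}\ge\tau$ such that $x_{i+1}^{-1}\psi_{\tau_i}(x_i)\in U$ for $i=0,\dots,n-1$. The chain recurrent set $\mathcal R_C(\psi)$ is the set of all $x\in K$ such that for every neighborhood $U$ of $e$ in $K$ and every $\tau>0$ there is a $(U,\tau)$-chain from $x$ to $x$. Then $$\mathcal R_C(\varphi)\cap G^{+,0}G^-=\mathcal R_C\left(\varphi|_{G^0}\right),$$ where $G^0$ carries the subspace topology and $\mathcal R_C(\varphi|_{G^0})\subset G^0$ is regarded as a subset of $G$.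 -/

import Mathlib

open scoped Manifold ContDiff Pointwise Topology

noncomputable section

namespace ChainRec

/-! ### Real Jordan decomposition of an endomorphism -/

section LinearAlgebra

variable {V : Type*} [AddCommGroup V] [Module ℝ V]

/-- Semisimple, with all complex eigenvalues real. -/
def IsHyperbolic (D : Module.End ℝ V) : Prop :=
  D.IsSemisimple ∧ ∀ μ : ℂ, Module.End.HasEigenvalue (LinearMap.baseChange ℂ D) μ → μ.im = 0

/-- Semisimple, with all complex eigenvalues on the imaginary axis. -/
def IsElliptic (D : Module.End ℝ V) : Prop :=
  D.IsSemisimple ∧ ∀ μ : ℂ, Module.End.HasEigenvalue (LinearMap.baseChange ℂ D) μ → μ.re = 0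

/-- `D = D_H + D_E + D_N` with commuting hyperbolic, elliptic and nilpotent summands. -/
structure IsJordanDecomposition (D : Module.End ℝ V)
    (P : Module.End ℝ V × Module.End ℝ V × Module.End ℝ V) : Prop where
  eq_add : D = P.1 + P.2.1 + P.2.2
  hyperbolic : IsHyperbolic P.1
  elliptic : IsElliptic P.2.1
  nilpotent : IsNilpotent P.2.2
  commute_HE : Commute P.1 P.2.1
  commute_HN : Commute P.1 P.2.2
  commute_EN : Commute P.2.1 P.2.2

theorem exists_real_interpolation (s : Finset ℂ)
    (hs : ∀ μ ∈ s, (starRingEnd ℂ) μ ∈ s) :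
    ∃ q : Polynomial ℝ, ∀ μ ∈ s, Polynomial.aeval μ q = (μ.re : ℂ) := by
  classical
  let p : Polynomial ℂ := Lagrange.interpolate s id (fun μ => (μ.re : ℂ))
  have hp : ∀ μ ∈ s, p.eval μ = (μ.re : ℂ) := fun μ hμ =>
    Lagrange.eval_interpolate_at_node (v := id) (fun μ : ℂ => (μ.re : ℂ))
      (Set.injOn_id _) hμ
  refine ⟨∑ i ∈ Finset.range (p.natDegree + 1), Polynomial.monomial i (p.coeff i).re, ?_⟩
  intro μ hμ
  have h1 := hp μ hμ
  have h2 := hp _ (hs μ hμ)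
  rw [Polynomial.eval_eq_sum_range] at h1 h2
  have h3 := congrArg (starRingEnd ℂ) h2
  simp only [map_sum, map_mul, map_pow, Complex.conj_conj, Complex.conj_re,
    Complex.conj_ofReal] at h3
  simp only [map_sum, Polynomial.aeval_monomial, Complex.coe_algebraMap]
  have h4 : (2 : ℂ) * ∑ i ∈ Finset.range (p.natDegree + 1), ((p.coeff i).re : ℂ) * μ ^ i
      = 2 * (μ.re : ℂ) := by
    rw [two_mul (μ.re : ℂ)]
    nth_rewrite 1 [← h1]
    rw [← h3, ← Finset.sum_add_distrib, Finset.mul_sum]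
    refine Finset.sum_congr rfl fun i _ => ?_
    rw [← add_mul, Complex.add_conj]
    push_cast
    ring
  exact mul_left_cancel₀ two_ne_zero h4

variable [FiniteDimensional ℝ V]

theorem eigenvalue_aeval (S : Module.End ℝ V) (q : Polynomial ℝ) (ν : ℂ)
    (h : Module.End.HasEigenvalue (LinearMap.baseChange ℂ (Polynomial.aeval S q)) ν) :
    ∃ μ : ℂ, Module.End.HasEigenvalue (LinearMap.baseChange ℂ S) μ ∧
      ν = Polynomial.aeval μ q := by
  have hnt : Nontrivial (TensorProduct ℝ ℂ V) := by
    obtain ⟨v, hv⟩ := h.exists_hasEigenvector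
    exact ⟨v, 0, hv.2⟩
  have key : LinearMap.baseChange ℂ (Polynomial.aeval S q)
      = Polynomial.aeval (LinearMap.baseChange ℂ S) (q.map (algebraMap ℝ ℂ)) := by
    rw [Polynomial.aeval_map_algebraMap]
    exact (Polynomial.aeval_algHom_apply (Module.End.baseChangeHom ℝ ℂ V) S q).symm
  rw [key] at h
  have h2 := h.mem_spectrum
  rw [spectrum.map_polynomial_aeval_of_nonempty _ _
    (spectrum.nonempty_of_isAlgClosed_of_finiteDimensional ℂ _)] at h2
  obtain ⟨μ, hμ, rfl⟩ := h2
  exact ⟨μ, Module.End.HasEigenvalue.of_mem_spectrum hμ, by simp [Polynomial.eval_map_algebraMap]⟩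

theorem exists_isJordanDecomposition (D : Module.End ℝ V) :
    ∃ P, IsJordanDecomposition D P := by
  classical
  obtain ⟨N, hN, S, hS, hnil, hss, hD⟩ := D.exists_isNilpotent_isSemisimple
  let s : Finset ℂ := ((minpoly ℝ S).aroots ℂ).toFinset
  have hm : minpoly ℝ S ≠ 0 := minpoly.ne_zero (Algebra.IsIntegral.isIntegral S)
  have hmem : ∀ μ : ℂ, μ ∈ s ↔ Polynomial.aeval μ (minpoly ℝ S) = 0 := fun μ => by
    simp [s, hm]
  obtain ⟨q, hq⟩ := exists_real_interpolation s (fun μ hμ => by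
    rw [hmem] at hμ ⊢
    rw [Polynomial.aeval_conj, hμ, map_zero])
  have heig : ∀ μ : ℂ, Module.End.HasEigenvalue (LinearMap.baseChange ℂ S) μ → μ ∈ s := by
    intro μ hμ
    rw [hmem]
    obtain ⟨v, hv⟩ := hμ.exists_hasEigenvector
    have h1 := Module.End.aeval_apply_of_hasEigenvector
      (p := (minpoly ℝ S).map (algebraMap ℝ ℂ)) hv
    have h0 : Polynomial.aeval (LinearMap.baseChange ℂ S) ((minpoly ℝ S).map (algebraMap ℝ ℂ))
        = 0 := by
      rw [Polynomial.aeval_map_algebraMap]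
      have := Polynomial.aeval_algHom_apply (Module.End.baseChangeHom ℝ ℂ V) S (minpoly ℝ S)
      rw [minpoly.aeval, map_zero] at this
      exact this
    rw [h0, LinearMap.zero_apply, Polynomial.eval_map_algebraMap] at h1
    exact (smul_eq_zero.mp h1.symm).resolve_right hv.2
  have hc : ∀ {a b c : Module.End ℝ V}, Commute a b → c ∈ Algebra.adjoin ℝ {a} → Commute c b :=
    fun hab hc => (Algebra.commute_of_mem_adjoin_of_forall_mem_commute hc
      (fun x hx => Set.mem_singleton_iff.mp hx ▸ hab.symm)).symm
  have hcSN : Commute S N := hc (hc (Commute.refl D) hN).symm hS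
  have hp : ∀ p : Polynomial ℝ, Polynomial.aeval S p ∈ Algebra.adjoin ℝ {S} :=
    fun p => Polynomial.aeval_mem_adjoin_singleton ℝ S
  refine ⟨(Polynomial.aeval S q, Polynomial.aeval S (Polynomial.X - q), N), ?_, ⟨?_, ?_⟩,
    ⟨?_, ?_⟩, hnil, ?_, ?_, ?_⟩
  · simp [hD, add_comm]
  · exact hss.aeval q
  · intro ν hν
    obtain ⟨μ, hμ, rfl⟩ := eigenvalue_aeval S q ν hν
    rw [hq μ (heig μ hμ), Complex.ofReal_im]
  · exact hss.aeval _
  · intro ν hν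
    obtain ⟨μ, hμ, rfl⟩ := eigenvalue_aeval S _ ν hν
    rw [map_sub, Polynomial.aeval_X, hq μ (heig μ hμ), Complex.sub_re, Complex.ofReal_re, sub_self]
  · exact hc (hc (Commute.refl S) (hp _)).symm (hp q)
  · exact hc hcSN (hp q)
  · exact hc hcSN (hp _)

/-- The (unique) triple `(D_H, D_E, D_N)` of the Jordan decomposition of `D`. -/
def jordanParts (D : Module.End ℝ V) : Module.End ℝ V × Module.End ℝ V × Module.End ℝ V :=
  (exists_isJordanDecomposition D).choose

theorem jordanParts_spec (D : Module.End ℝ V) : IsJordanDecomposition D (jordanParts D) :=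
  (exists_isJordanDecomposition D).choose_spec

/-- The sum of the eigenspaces of `D_H` for positive eigenvalues. -/
def unstableSubspace (D : Module.End ℝ V) : Submodule ℝ V :=
  ⨆ (r : ℝ) (_ : 0 < r), Module.End.eigenspace (jordanParts D).1 r

/-- The sum of the eigenspaces of `D_H` for negative eigenvalues. -/
def stableSubspace (D : Module.End ℝ V) : Submodule ℝ V :=
  ⨆ (r : ℝ) (_ : r < 0), Module.End.eigenspace (jordanParts D).1 r

end LinearAlgebra

/-! ### Chains -/

section Chains

variable {K : Type*} [Group K] [TopologicalSpace K]

/-- There is a `(U, τ)`-chain with at least one jump from `x` to `y`. -/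
def HasChain (φ : ℝ → K → K) (U : Set K) (τ : ℝ) (x y : K) : Prop :=
  ∃ (n : ℕ) (z : ℕ → K) (σ : ℕ → ℝ), 0 < n ∧ z 0 = x ∧ z n = y ∧
    ∀ i < n, τ ≤ σ i ∧ (z (i + 1))⁻¹ * φ (σ i) (z i) ∈ U

/-- The chain limit set `Ω(x)`. -/
def chainLimitSet (φ : ℝ → K → K) (x : K) : Set K :=
  {y | ∀ U ∈ 𝓝 (1 : K), ∀ τ : ℝ, 0 < τ → HasChain φ U τ x y}

/-- The chain recurrent set. -/
def chainRecurrentSet (φ : ℝ → K → K) : Set K :=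
  {x | x ∈ chainLimitSet φ x}

end Chains

/-! ### Flows of automorphisms of a Lie group -/

section LieGroup

variable {E : Type*} [NormedAddCommGroup E] [NormedSpace ℝ E]

/-- A flow of automorphisms: a one-parameter group of automorphisms of the group `G`, acting
smoothly. -/
structure AutFlow (E : Type*) [NormedAddCommGroup E] [NormedSpace ℝ E]
    (G : Type*) [TopologicalSpace G] [ChartedSpace E G] [Group G] where
  toFun : ℝ → G → G
  contMDiff' : ContMDiff (𝓘(ℝ, ℝ).prod 𝓘(ℝ, E)) 𝓘(ℝ, E) ∞ (fun p : ℝ × G => toFun p.1 p.2)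
  map_mul' : ∀ t x y, toFun t (x * y) = toFun t x * toFun t y
  map_zero' : ∀ x, toFun 0 x = x
  map_add' : ∀ s t x, toFun (s + t) x = toFun s (toFun t x)

variable {G : Type*} [TopologicalSpace G] [ChartedSpace E G] [Group G]

instance : CoeFun (AutFlow E G) (fun _ => ℝ → G → G) := ⟨AutFlow.toFun⟩

/-- `X = γ'(0)` for the smooth one-parameter subgroup `γ` of `G`, that is,
`γ t = exp (t X)`. -/
structure IsOneParameterSubgroup (γ : ℝ → G) (X : GroupLieAlgebra 𝓘(ℝ, E) G) : Prop where
  contMDiff : ContMDiff 𝓘(ℝ, ℝ) 𝓘(ℝ, E) ∞ γ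
  map_add : ∀ s t, γ (s + t) = γ s * γ t
  deriv_zero : (mfderiv 𝓘(ℝ, ℝ) 𝓘(ℝ, E) γ 0 : ℝ →L[ℝ] E) 1 = X

/-- The connected subgroup of `G` with Lie algebra `h` (for `h` a Lie subalgebra): the subgroup
generated by `exp h`. -/
def connectedSubgroup (h : Submodule ℝ (GroupLieAlgebra 𝓘(ℝ, E) G)) : Subgroup G :=
  Subgroup.closure {g | ∃ X ∈ h, ∃ γ : ℝ → G, IsOneParameterSubgroup γ X ∧ γ 1 = g}

namespace AutFlow

/-- The derivation `D` of the Lie algebra with `(dφ_t)_e = exp (t D)`, as the derivative of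
`t ↦ (dφ_t)_e` at `t = 0`. -/
def derivation (φ : AutFlow E G) : Module.End ℝ (GroupLieAlgebra 𝓘(ℝ, E) G) :=
  ((deriv (fun t : ℝ => (mfderiv 𝓘(ℝ, E) 𝓘(ℝ, E) (φ t) (1 : G) : E →L[ℝ] E)) 0 :
    E →L[ℝ] E) : E →ₗ[ℝ] E)

theorem map_one (φ : AutFlow E G) (t : ℝ) : φ t 1 = 1 := by
  have h := φ.map_mul' t 1 1
  rw [mul_one] at h
  exact left_eq_mul.mp h

theorem map_inv (φ : AutFlow E G) (t : ℝ) (x : G) : φ t x⁻¹ = (φ t x)⁻¹ := by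
  rw [eq_inv_iff_mul_eq_one, ← φ.map_mul', inv_mul_cancel, φ.map_one]

instance [FiniteDimensional ℝ E] : FiniteDimensional ℝ (GroupLieAlgebra 𝓘(ℝ, E) G) :=
  inferInstanceAs (FiniteDimensional ℝ E)

variable [FiniteDimensional ℝ E]

/-- The Jordan decomposition `φ_t = φ^H_t ∘ φ^E_t ∘ φ^N_t` of a flow of automorphisms into the
commuting flows of automorphisms associated with the parts `D_H, D_E, D_N` of its derivation. -/
structure IsJordanDecomposition (φ φH φE φN : AutFlow E G) : Prop where
  eq_comp : ∀ t x, φ t x = φH t (φE t (φN t x))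
  commute_HE : ∀ s t x, φH s (φE t x) = φE t (φH s x)
  commute_HN : ∀ s t x, φH s (φN t x) = φN t (φH s x)
  commute_EN : ∀ s t x, φE s (φN t x) = φN t (φE s x)
  derivation_H : φH.derivation = (jordanParts φ.derivation).1
  derivation_E : φE.derivation = (jordanParts φ.derivation).2.1
  derivation_N : φN.derivation = (jordanParts φ.derivation).2.2

/-- The unstable subgroup `G⁺`. -/
def unstableSubgroup (φ : AutFlow E G) : Subgroup G :=
  connectedSubgroup (E := E) (unstableSubspace φ.derivation)

/-- The stable subgroup `G⁻`. -/
def stableSubgroup (φ : AutFlow E G) : Subgroup G :=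
  connectedSubgroup (E := E) (stableSubspace φ.derivation)

/-- The central subgroup `G⁰`: the fixed points of the hyperbolic part of `φ` (the Jordan
decomposition of a flow of automorphisms of a connected Lie group exists and is unique). -/
def centralSubgroup (φ : AutFlow E G) : Subgroup G where
  carrier := {g | ∀ φH φE φN : AutFlow E G, IsJordanDecomposition φ φH φE φN → ∀ t, φH t g = g}
  mul_mem' {a b} ha hb φH φE φN h t := by
    rw [φH.map_mul', ha φH φE φN h t, hb φH φE φN h t]
  one_mem' φH _ _ _ t := φH.map_one t
  inv_mem' {a} ha φH φE φN h t := by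
    rw [φH.map_inv, ha φH φE φN h t]

theorem map_mem_centralSubgroup (φ : AutFlow E G) (t : ℝ) {x : G}
    (hx : x ∈ φ.centralSubgroup) : φ t x ∈ φ.centralSubgroup := by
  intro φH φE φN h s
  rw [h.eq_comp, ← φH.map_add', add_comm, φH.map_add', h.commute_HE, h.commute_HN,
    hx φH φE φN h s]

/-- The restriction `φ|_{G⁰}`. -/
def restrictCentral (φ : AutFlow E G) : ℝ → φ.centralSubgroup → φ.centralSubgroup :=
  fun t x => ⟨φ t x, φ.map_mem_centralSubgroup t x.2⟩

end AutFlow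

end LieGroup

end ChainRec

end

/-!
Let `φH` be the hyperbolic part of `φ`. The points that `φH` contracts to `1` as `t → ∞` and as
`t → -∞` form subgroups `S ⊇ G⁻` and `U ⊇ G⁺`, both normalized by `Z = G⁰`. One-parameter subgroups
through an eigenbasis of `D_H` give coordinates of the second kind, so `U Z S` contains a
neighborhood of `1`, in which the stable factor is contracted uniformly by `φ`. The product is
direct because the velocity `s ↦ φH_s(g) g⁻¹` at `0` evolves by `(dφH_t)_e`, which leaves no nonzero
vector contracted in both time directions.

A fine chain starting in `U Z S` then stays close to `U Z`, because in `U \ G` the subset `Z S` is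
attracted to `Z`. Hence a chain recurrent point `u z s` has `s = 1`, and reversing time, which
preserves chain recurrence, gives `u = 1`. The `Z`-components of a chain from `z` to `z` form a
chain in `G⁰`, so `z` is chain recurrent for the restriction.
-/

noncomputable section

namespace ChainRec

open Filter Set

/-! ### Chains -/

section Chains

variable {K L : Type*} [Group K] [Group L] {φ : ℝ → K → K} {ψ : ℝ → L → L} {U : Set K} {τ : ℝ}
  {x y z : K}

/-- One jump of a `(U, τ)`-chain. Chains are paths of such jumps, so that statements about them
can be proved by induction on the transitive closure of this relation. -/
def ChainStep (φ : ℝ → K → K) (U : Set K) (τ : ℝ) (x y : K) : Prop :=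
  ∃ σ : ℝ, τ ≤ σ ∧ y⁻¹ * φ σ x ∈ U

theorem ChainStep.hasChain (h : ChainStep φ U τ x y) : HasChain φ U τ x y := by
  obtain ⟨σ, hσ⟩ := h
  refine ⟨1, fun i => if i = 0 then x else y, fun _ => σ, one_pos, by simp, by simp, ?_⟩
  intro i hi
  obtain rfl : i = 0 := by omega
  simpa using hσ

theorem HasChain.tail (h : HasChain φ U τ x y) (h' : ChainStep φ U τ y z) :
    HasChain φ U τ x z := by
  obtain ⟨n, p, ρ, -, h0, hn, hp⟩ := h
  obtain ⟨σ, hσ⟩ := h'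
  refine ⟨n + 1, fun i => if i ≤ n then p i else z, fun i => if i < n then ρ i else σ,
    n.succ_pos, by simp [h0], by simp, fun i hi => ?_⟩
  rcases Nat.lt_succ_iff_lt_or_eq.mp hi with h | rfl
  · simpa [h, h.le, Nat.succ_le_of_lt h] using hp i h
  · simpa [hn] using hσ

theorem hasChain_iff_transGen : HasChain φ U τ x y ↔ Relation.TransGen (ChainStep φ U τ) x y := by
  constructor
  · rintro ⟨n, p, σ, hn, rfl, rfl, hp⟩
    induction n, hn using Nat.le_induction with
    | base => exact .single ⟨σ 0, hp 0 one_pos⟩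
    | succ n _ ih =>
      exact (ih fun i hi => hp i (hi.trans n.lt_succ_self)).tail ⟨σ n, hp n n.lt_succ_self⟩
  · intro h
    induction h with
    | single h => exact h.hasChain
    | tail _ h ih => exact ih.tail h

theorem HasChain.map (f : K →* L) (hf : ∀ t x, f (φ t x) = ψ t (f x)) {V : Set L}
    (hUV : MapsTo f U V) (h : HasChain φ U τ x y) : HasChain ψ V τ (f x) (f y) := by
  obtain ⟨n, p, σ, hn, rfl, rfl, hp⟩ := h
  refine ⟨n, f ∘ p, σ, hn, rfl, rfl, fun i hi => ⟨(hp i hi).1, ?_⟩⟩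
  simpa [hf] using hUV (hp i hi).2

theorem map_mem_chainRecurrentSet [TopologicalSpace K] [TopologicalSpace L] (f : K →* L)
    (hc : Continuous f) (hf : ∀ t x, f (φ t x) = ψ t (f x)) (hx : x ∈ chainRecurrentSet φ) :
    f x ∈ chainRecurrentSet ψ := fun V hV τ hτ =>
  (hx (f ⁻¹' V) (hc.tendsto' 1 1 (map_one f) hV) τ hτ).map f hf (mapsTo_preimage f V)

end Chains

/-! ### Flows of automorphisms of a topological group with a hyperbolic splitting -/

section TopologicalGroup

variable {K : Type*} [Group K] [TopologicalSpace K]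

/-- A continuous one-parameter group of automorphisms of a topological group. -/
structure IsAutFlow (φ : ℝ → K → K) : Prop where
  continuous : Continuous fun p : ℝ × K => φ p.1 p.2
  map_mul : ∀ t x y, φ t (x * y) = φ t x * φ t y
  map_zero : ∀ x, φ 0 x = x
  map_add : ∀ s t x, φ (s + t) x = φ s (φ t x)

namespace IsAutFlow

variable {φ : ℝ → K → K} {U : Set K} {τ : ℝ}

theorem map_one (hφ : IsAutFlow φ) (t : ℝ) : φ t 1 = 1 :=
  _root_.map_one (MonoidHom.mk' (φ t) (hφ.map_mul t))

theorem map_inv (hφ : IsAutFlow φ) (t : ℝ) (x : K) : φ t x⁻¹ = (φ t x)⁻¹ :=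
  _root_.map_inv (MonoidHom.mk' (φ t) (hφ.map_mul t)) x

theorem neg_apply_apply (hφ : IsAutFlow φ) (t : ℝ) (x : K) : φ (-t) (φ t x) = x := by
  rw [← hφ.map_add, neg_add_cancel, hφ.map_zero]

theorem continuous_apply (hφ : IsAutFlow φ) (t : ℝ) : Continuous (φ t) :=
  hφ.continuous.comp (Continuous.prodMk_right t)

theorem reverse (hφ : IsAutFlow φ) : IsAutFlow fun t => φ (-t) where
  continuous := hφ.continuous.comp (by fun_prop : Continuous fun p : ℝ × K => (-p.1, p.2))
  map_mul t := hφ.map_mul (-t)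
  map_zero x := by rw [neg_zero, hφ.map_zero]
  map_add s t x := by rw [neg_add, hφ.map_add]

theorem transGen_of_chainStep (hφ : IsAutFlow φ) (hU : 1 ∈ U) (hτ : 0 < τ) {x y : K}
    (h : ChainStep φ U τ x y) :
    Relation.TransGen (fun a b => ∃ σ ∈ Icc τ (2 * τ), b⁻¹ * φ σ a ∈ U) x y := by
  obtain ⟨σ, hσ, hxy⟩ := h
  obtain ⟨n, hn⟩ := exists_nat_ge (σ / τ)
  rw [div_le_iff₀ hτ] at hn
  induction n generalizing x σ with
  | zero => exact absurd hn (by push_cast; linarith)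
  | succ n ih =>
    by_cases h2 : σ ≤ 2 * τ
    · exact .single ⟨σ, ⟨hσ, h2⟩, hxy⟩
    · refine .head (b := φ τ x) ⟨τ, ⟨le_rfl, by linarith⟩, by simpa using hU⟩
        (ih (σ - τ) (by linarith) ?_ (by push_cast at hn; linarith))
      rw [← hφ.map_add, sub_add_cancel]
      exact hxy

theorem hasChain_reverse (hφ : IsAutFlow φ) {V : Set K} (hV : 1 ∈ V) (hτ : 0 < τ)
    (hVU : ∀ v ∈ V, ∀ σ ∈ Icc τ (2 * τ), (φ (-σ) v)⁻¹ ∈ U) {x y : K} (h : HasChain φ V τ x y) :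
    HasChain (fun t => φ (-t)) U τ y x := by
  rw [hasChain_iff_transGen, ← Relation.transGen_swap]
  refine Relation.TransGen.closed (fun a b hab => ?_) _ _ (hasChain_iff_transGen.mp h)
  refine (hφ.transGen_of_chainStep hV hτ hab).mono ?_ _ _
  rintro a b ⟨σ, hσ, hab⟩
  refine ⟨σ, hσ.1, ?_⟩
  simpa [hφ.map_mul, hφ.map_inv, hφ.neg_apply_apply] using hVU _ hab σ hσ

theorem chainRecurrentSet_subset_reverse [ContinuousInv K] (hφ : IsAutFlow φ) :
    chainRecurrentSet φ ⊆ chainRecurrentSet fun t => φ (-t) := by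
  intro x hx U hU τ hτ
  have hc : Continuous fun p : K × ℝ => (φ (-p.2) p.1)⁻¹ :=
    (hφ.reverse.continuous.comp continuous_swap).inv
  have hev : ∀ᶠ u in 𝓝 (1 : K), ∀ σ ∈ Icc τ (2 * τ), (φ (-σ) u)⁻¹ ∈ U := by
    refine isCompact_Icc.eventually_forall_of_forall_eventually fun σ _ =>
      hc.continuousAt.eventually_mem ?_
    simpa [hφ.map_one] using hU
  exact hφ.hasChain_reverse (mem_of_mem_nhds hev) hτ (fun _ h => h) (hx _ hev τ hτ)

end IsAutFlow

/-- A flow of automorphisms preserving subgroups `Z` and `U` such that `Z` normalizes `U`, the flow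
contracts `S` in forward time, and the product `U Z S` is direct and covers a neighborhood of `1`.
In `local_product` the stable factor ranges over a small set `C` that is contracted uniformly. -/
structure HyperbolicSplitting (φ : ℝ → K → K) (S Z U : Subgroup K) : Prop where
  flow : IsAutFlow φ
  map_central : ∀ t, ∀ x ∈ Z, φ t x ∈ Z
  map_unstable : ∀ t, ∀ x ∈ U, φ t x ∈ U
  conj_mem : ∀ z ∈ Z, ∀ u ∈ U, z * u * z⁻¹ ∈ U
  eq_one_of_mem_stable : ∀ u ∈ U, ∀ z ∈ Z, u * z ∈ S → u * z = 1
  eq_one_of_mem_central : ∀ u ∈ U, u ∈ Z → u = 1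
  tendsto_stable : ∀ s ∈ S, Tendsto (fun t => φ t s) atTop (𝓝 1)
  local_product : ∀ V ∈ 𝓝 (1 : K), ∃ C ⊆ (S : Set K) ∩ V,
    (∀ W ∈ 𝓝 (1 : K), ∀ᶠ t in atTop, ∀ c ∈ C, φ t c ∈ W) ∧
    {x | ∃ u ∈ U, ∃ z ∈ Z, z ∈ V ∧ ∃ c ∈ C, x = u * z * c} ∈ 𝓝 (1 : K)

namespace HyperbolicSplitting

variable {φ : ℝ → K → K} {S Z U : Subgroup K}

/-- The restriction `φ|_Z` of the flow to the central subgroup. -/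
def restrict (h : HyperbolicSplitting φ S Z U) (t : ℝ) (z : Z) : Z :=
  ⟨φ t z, h.map_central t z z.2⟩

theorem eq_one_of_mul_eq (h : HyperbolicSplitting φ S Z U) {u z s u' z' : K} (hu : u ∈ U)
    (hz : z ∈ Z) (hs : s ∈ S) (hu' : u' ∈ U) (hz' : z' ∈ Z) (he : u * z * s = u' * z') :
    s = 1 := by
  have hs' : (z⁻¹ * (u⁻¹ * u') * z⁻¹⁻¹) * (z⁻¹ * z') = s := by
    rw [← mul_right_inj (u * z), he]
    group
  rw [← hs'] at hs ⊢
  exact h.eq_one_of_mem_stable _ (h.conj_mem _ (Z.inv_mem hz) _ (U.mul_mem (U.inv_mem hu) hu')) _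
    (Z.mul_mem (Z.inv_mem hz) hz') hs

variable [IsTopologicalGroup K]

theorem exists_step (h : HyperbolicSplitting φ S Z U) {V : Set K} (hV : V ∈ 𝓝 1) :
    ∃ C ⊆ (S : Set K) ∩ V, ∃ W ∈ 𝓝 (1 : K),
      (∀ᶠ t in atTop, ∀ c ∈ C, φ t c ∈ W) ∧
      ∀ t, ∀ u ∈ U, ∀ z ∈ Z, ∀ c, φ t c ∈ W → ∀ b, b⁻¹ * φ t (u * z * c) ∈ W →
        ∃ u' ∈ U, ∃ z' ∈ Z, z' ∈ V ∧ ∃ c' ∈ C, b = u' * (φ t z * z') * c' := by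
  obtain ⟨C, hC, hunif, hprod⟩ := h.local_product V hV
  have hdiv : Tendsto (fun p : K × K => p.1 * p.2⁻¹) (𝓝 1 ×ˢ 𝓝 1) (𝓝 1) := by
    rw [← nhds_prod_eq]
    exact Continuous.tendsto' (by fun_prop) _ _ (by simp)
  obtain ⟨W, hW, hWW⟩ := mem_prod_self_iff.mp (hdiv hprod)
  refine ⟨C, hC, W, hW, hunif W hW, fun t u hu z hz c hc b hb => ?_⟩
  obtain ⟨u', hu', z', hz', hz'V, c', hc', he⟩ := hWW (mk_mem_prod hc hb)
  refine ⟨φ t u * (φ t z * u' * (φ t z)⁻¹), U.mul_mem (h.map_unstable t u hu)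
    (h.conj_mem _ (h.map_central t z hz) _ hu'), z', hz', hz'V, c', hc', ?_⟩
  calc b = φ t u * φ t z * (φ t c * (b⁻¹ * φ t (u * z * c))⁻¹) := by
        simp only [h.flow.map_mul]; group
    _ = φ t u * φ t z * (u' * z' * c') := by rw [← he]
    _ = φ t u * (φ t z * u' * (φ t z)⁻¹) * (φ t z * z') * c' := by group

/-- In the right coset space `U\K` the orbit `Z` attracts `Z S`, so a fine chain starting in
`U Z S` stays close to `U Z`, and its `Z`-components form a chain of their own. -/
theorem exists_hasChain_restrict (h : HyperbolicSplitting φ S Z U) {V : Set K} (hV : V ∈ 𝓝 1)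
    {τ : ℝ} (hτ : 0 < τ) {s : K} (hs : s ∈ S) :
    ∃ C ⊆ (S : Set K) ∩ V, ∃ W ∈ 𝓝 (1 : K), ∃ T > 0, ∀ u ∈ U, ∀ z : Z, ∀ b,
      HasChain φ W T (u * z * s) b →
        ∃ u' ∈ U, ∃ z' : Z, ∃ c ∈ C, b = u' * z' * c ∧
          HasChain h.restrict ((↑) ⁻¹' V) τ z z' := by
  obtain ⟨C, hC, W, hW, hunif, hstep⟩ :=
    h.exists_step (inter_mem hV (inv_mem_nhds_one K hV))
  obtain ⟨T, hT⟩ := eventually_atTop.mp (hunif.and ((h.tendsto_stable s hs).eventually_mem hW))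
  have hstep' : ∀ {u c b : K} {z : Z}, u ∈ U → (∀ σ ≥ T, φ σ c ∈ W) →
      ChainStep φ W (max T τ) (u * z * c) b → ∃ u' ∈ U, ∃ z' : Z, ∃ c' ∈ C, b = u' * z' * c' ∧
        ChainStep h.restrict ((↑) ⁻¹' V) τ z z' := by
    rintro u c b z hu hc ⟨σ, hσ, hb⟩
    obtain ⟨u', hu', z', hz', hz'V, c', hc', he⟩ :=
      hstep σ u hu z z.2 c (hc σ ((le_max_left _ _).trans hσ)) b hb
    exact ⟨u', hu', h.restrict σ z * (⟨z', hz'⟩ : Z), c', hc', he, σ, (le_max_right _ _).trans hσ,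
      by simpa using hz'V.2⟩
  refine ⟨C, fun c hc => ⟨(hC hc).1, (hC hc).2.1⟩, W, hW, max T τ, lt_max_of_lt_right hτ,
    fun u hu z b hb => ?_⟩
  rw [hasChain_iff_transGen] at hb
  induction hb with
  | single hb =>
    obtain ⟨u', hu', z', c, hc, he, hz⟩ := hstep' hu (fun σ hσ => (hT σ hσ).2) hb
    exact ⟨u', hu', z', c, hc, he, hz.hasChain⟩
  | tail _ hb ih =>
    obtain ⟨u', hu', z', c, hc, rfl, hz⟩ := ih
    obtain ⟨u'', hu'', z'', c', hc', he, hz'⟩ := hstep' hu' (fun σ hσ => (hT σ hσ).1 c hc) hb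
    exact ⟨u'', hu'', z'', c', hc', he, hz.tail hz'⟩

theorem mem_chainRecurrentSet_restrict (h : HyperbolicSplitting φ S Z U) {x : Z}
    (hx : (x : K) ∈ chainRecurrentSet φ) : x ∈ chainRecurrentSet h.restrict := by
  intro V hV τ hτ
  obtain ⟨V', hV', hVV⟩ := (mem_nhds_subtype _ _ _).mp hV
  obtain ⟨C, hC, W, hW, T, hT, hproj⟩ := h.exists_hasChain_restrict hV' hτ S.one_mem
  obtain ⟨u, hu, z, c, hc, he, hz⟩ := hproj 1 U.one_mem x x (by simpa using hx W hW T hT)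
  obtain rfl : c = 1 := h.eq_one_of_mul_eq hu z.2 (hC hc).1 U.one_mem x.2 (by rw [← he, one_mul])
  rw [mul_one] at he
  obtain rfl : u = 1 := h.eq_one_of_mem_central u hu (by
    rw [eq_mul_inv_iff_mul_eq.mpr he.symm]
    exact Z.mul_mem x.2 (Z.inv_mem z.2))
  obtain rfl : x = z := Subtype.ext (by rw [he, one_mul])
  exact hz.map (ψ := h.restrict) (MonoidHom.id Z) (fun _ _ => rfl) hVV

variable [T1Space K]

theorem stable_part_eq_one (h : HyperbolicSplitting φ S Z U) {u z s : K} (hu : u ∈ U)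
    (hz : z ∈ Z) (hs : s ∈ S) (hx : u * z * s ∈ chainRecurrentSet φ) : s = 1 := by
  by_contra hne
  have hV : ({s}ᶜ : Set K) ∈ 𝓝 1 := isOpen_compl_singleton.mem_nhds (Ne.symm hne)
  obtain ⟨C, hC, W, hW, T, hT, hproj⟩ := h.exists_hasChain_restrict hV one_pos hs
  obtain ⟨u', hu', z', c, hc, he, -⟩ := hproj u hu ⟨z, hz⟩ _ (hx W hW T hT)
  have hsc := h.eq_one_of_mul_eq hu hz (S.mul_mem hs (S.inv_mem (hC hc).1)) hu' z'.2
    (by rw [← mul_assoc, he, mul_inv_cancel_right])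
  exact (hC hc).2 (mul_inv_eq_one.mp hsc).symm

theorem chainRecurrentSet_inter_subset (h : HyperbolicSplitting φ S Z U)
    (h' : HyperbolicSplitting (fun t => φ (-t)) U Z S) :
    chainRecurrentSet φ ∩ ((U : Set K) * (Z : Set K) * (S : Set K)) ⊆
      Subtype.val '' chainRecurrentSet h.restrict := by
  rintro _ ⟨hx, _, ⟨u, hu, z, hz, rfl⟩, s, hs, rfl⟩
  simp only at hx ⊢
  obtain rfl : s = 1 := h.stable_part_eq_one hu hz hs hx
  rw [mul_one] at hx ⊢
  have hconj : z⁻¹ * u * z = 1 := by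
    refine h'.stable_part_eq_one S.one_mem hz
      (by simpa using h.conj_mem _ (Z.inv_mem hz) _ hu) ?_
    rw [one_mul, ← mul_assoc, mul_inv_cancel_left]
    exact h.flow.chainRecurrentSet_subset_reverse hx
  obtain rfl : u = 1 := by
    rwa [mul_assoc, inv_mul_eq_one, right_eq_mul] at hconj
  rw [one_mul] at hx ⊢
  exact ⟨⟨z, hz⟩, h.mem_chainRecurrentSet_restrict hx, rfl⟩

end HyperbolicSplitting

end TopologicalGroup

/-! ### Diagonalizability and growth of one-parameter groups of linear maps -/

section Diagonalizable

open Polynomial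

theorem ker_aeval_prod_le_iSup_eigenspace {𝕜 V : Type*} [Field 𝕜] [AddCommGroup V] [Module 𝕜 V]
    (D : Module.End 𝕜 V) (s : Finset 𝕜) :
    LinearMap.ker (aeval D (∏ r ∈ s, (X - C r))) ≤ ⨆ r, D.eigenspace r := by
  classical
  induction s using Finset.induction_on with
  | empty => simp [Module.End.one_eq_id]
  | insert a s ha ih =>
    have hcop : IsCoprime (X - C a) (∏ r ∈ s, (X - C r)) := IsCoprime.prod_right fun r hr =>
      pairwise_coprime_X_sub_C Function.injective_id fun h : a = r => ha (h ▸ hr)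
    rw [Finset.prod_insert ha, ← sup_ker_aeval_eq_ker_aeval_mul_of_coprime _ hcop]
    refine sup_le (le_trans (le_of_eq ?_) (le_iSup _ a)) ih
    simp [Module.End.eigenspace_def, Algebra.algebraMap_eq_smul_one]

variable {V : Type*} [AddCommGroup V] [Module ℝ V] {D : Module.End ℝ V}

theorem baseChange_aeval (D : Module.End ℝ V) (p : ℝ[X]) :
    (aeval D p).baseChange ℂ = aeval (LinearMap.baseChange ℂ D) (p.map (algebraMap ℝ ℂ)) := by
  rw [aeval_map_algebraMap]
  exact (aeval_algHom_apply (Module.End.baseChangeHom ℝ ℂ V) D p).symm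

variable [FiniteDimensional ℝ V]

theorem iSup_eigenspace_baseChange_eq_top (hD : D.IsSemisimple) :
    ⨆ μ : ℂ, Module.End.eigenspace (D.baseChange ℂ) μ = ⊤ := by
  apply Module.End.IsSemisimple.iSup_eigenspace_eq_top
  refine Module.End.isSemisimple_of_squarefree_aeval_eq_zero
    (p := (minpoly ℝ D).map (algebraMap ℝ ℂ)) ?_ ?_
  · exact (PerfectField.separable_iff_squarefree.mpr hD.minpoly_squarefree).map.squarefree
  · rw [← baseChange_aeval, minpoly.aeval, LinearMap.baseChange_zero]

theorem aeval_eq_zero_of_forall_eigenvalue (hD : D.IsSemisimple) {p : ℝ[X]}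
    (hp : ∀ μ : ℂ, Module.End.HasEigenvalue (D.baseChange ℂ) μ → aeval μ p = 0) :
    aeval D p = 0 := by
  have hzero : (aeval D p).baseChange ℂ = 0 := by
    rw [baseChange_aeval, ← LinearMap.ker_eq_top, ← top_le_iff,
      ← iSup_eigenspace_baseChange_eq_top hD]
    refine iSup_le fun μ w hw => LinearMap.mem_ker.mpr ?_
    obtain rfl | h0 := eq_or_ne w 0
    · exact map_zero _
    · have hμ := hp μ (Module.End.hasEigenvalue_of_hasEigenvector ⟨hw, h0⟩)
      rw [Module.End.aeval_apply_of_hasEigenvector ⟨hw, h0⟩, eval_map_algebraMap, hμ, zero_smul]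
  ext v
  have h := LinearMap.congr_fun hzero (1 ⊗ₜ[ℝ] v)
  rw [LinearMap.baseChange_tmul, LinearMap.zero_apply] at h
  exact Module.FaithfullyFlat.tensorProduct_mk_injective (A := ℝ) (B := ℂ) V
    (h.trans (TensorProduct.tmul_zero _ _).symm)

theorem IsHyperbolic.iSup_eigenspace_eq_top (hD : IsHyperbolic D) :
    ⨆ r : ℝ, D.eigenspace r = ⊤ := by
  classical
  let s : Finset ℝ :=
    (Module.End.finite_hasEigenvalue (f := D.baseChange ℂ)).toFinset.image Complex.re
  have hs : aeval D (∏ r ∈ s, (X - C r)) = 0 := by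
    refine aeval_eq_zero_of_forall_eigenvalue hD.1 fun μ hμ => ?_
    rw [map_prod]
    refine Finset.prod_eq_zero (Finset.mem_image_of_mem _ (by simpa using hμ) : μ.re ∈ s) ?_
    simp [sub_eq_zero, Complex.ext_iff, hD.2 μ hμ]
  refine top_le_iff.mp (le_trans ?_ (ker_aeval_prod_le_iSup_eigenspace D s))
  rw [hs, LinearMap.ker_zero]

end Diagonalizable

section Growth

theorem tendsto_exp_mul_one_add_abs_pow {r : ℝ} {l : Filter ℝ}
    (hl : Tendsto (fun t => r * t) l atBot) (k : ℕ) :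
    Tendsto (fun t => Real.exp (r * t) * (1 + |t|) ^ k) l (𝓝 0) := by
  have h := ((1 + .C |r|⁻¹ * .X : Polynomial ℝ) ^ k).tendsto_div_exp_atTop.comp
    (tendsto_neg_atBot_atTop.comp hl)
  refine h.congr' ?_
  filter_upwards [hl.eventually_lt_atBot 0] with t ht
  have hr : |r| ≠ 0 := abs_ne_zero.mpr fun h => by simp [h] at ht
  have habs : |r|⁻¹ * -(r * t) = |t| := by
    rw [← abs_of_neg ht, abs_mul, inv_mul_cancel_left₀ hr]
  simp only [Function.comp_apply, Polynomial.eval_pow, Polynomial.eval_add, Polynomial.eval_one,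
    Polynomial.eval_mul, Polynomial.eval_C, Polynomial.eval_X, habs, Real.exp_neg, div_inv_eq_mul,
    mul_comm]

theorem eq_exp_smul_of_hasDerivAt {𝕜 F : Type*} [RCLike 𝕜] [NormedAddCommGroup F] [NormedSpace ℝ F]
    [NormedSpace 𝕜 F] [IsScalarTower ℝ 𝕜 F] {c : 𝕜} {f : ℝ → F}
    (hf : ∀ t, HasDerivAt f (c • f t) t) (t : ℝ) : f t = NormedSpace.exp (t • c) • f 0 := by
  have hd : ∀ t, HasDerivAt (fun t : ℝ => NormedSpace.exp (t • -c) • f t) 0 t := fun t => by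
    refine ((hasDerivAt_exp_smul_const (-c) t).smul (hf t)).congr_deriv ?_
    rw [smul_smul, ← add_smul, mul_neg, add_neg_cancel, zero_smul]
  have hconst := is_const_of_deriv_eq_zero (fun t => (hd t).differentiableAt)
    (fun t => (hd t).deriv) t 0
  rw [zero_smul, NormedSpace.exp_zero, one_smul] at hconst
  rw [← hconst, smul_smul, ← NormedSpace.exp_add, ← smul_add, add_neg_cancel, smul_zero,
    NormedSpace.exp_zero, one_smul]

variable {E : Type*} [NormedAddCommGroup E] [NormedSpace ℝ E]

/-- `A t = exp (t D)`, as the solution of a differential equation. -/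
structure IsLinearFlow (A : ℝ → E →L[ℝ] E) (D : E →L[ℝ] E) : Prop where
  map_zero : A 0 = 1
  hasDerivAt : ∀ t, HasDerivAt A (A t * D) t

namespace IsLinearFlow

variable {A : ℝ → E →L[ℝ] E} {D : E →L[ℝ] E}

theorem hasDerivAt_apply (h : IsLinearFlow A D) (X : E) (t : ℝ) :
    HasDerivAt (fun t => A t X) (A t (D X)) t :=
  (ContinuousLinearMap.apply ℝ E X).hasFDerivAt.comp_hasDerivAt t (h.hasDerivAt t)

theorem apply_eigenvector (h : IsLinearFlow A D) {X : E} {r : ℝ} (hX : D X = r • X) (t : ℝ) :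
    A t X = Real.exp (r * t) • X := by
  have hd (t : ℝ) : HasDerivAt (fun t => A t X) (r • A t X) t := by
    rw [← map_smul, ← hX]
    exact h.hasDerivAt_apply X t
  rw [eq_exp_smul_of_hasDerivAt hd t, h.map_zero, one_apply_eq_self, Real.exp_eq_exp_ℝ, smul_eq_mul,
    mul_comm]

theorem norm_apply_le_of_pow_apply_eq_zero (h : IsLinearFlow A D) (k : ℕ) {X : E}
    (hX : (D ^ k) X = 0) : ∃ C : ℝ, ∀ t, ‖A t X‖ ≤ C * (1 + |t|) ^ k := by
  induction k generalizing X with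
  | zero =>
    rw [pow_zero, one_apply_eq_self] at hX
    exact ⟨0, fun t => by simp [hX]⟩
  | succ k ih =>
    obtain ⟨C, hC⟩ := ih (X := D X) (by rwa [pow_succ] at hX)
    have hC0 : 0 ≤ C := by simpa using (norm_nonneg _).trans (hC 0)
    refine ⟨‖X‖ + C, fun t => ?_⟩
    have hmv : ‖A t X - X‖ ≤ C * (1 + |t|) ^ k * |t| := by
      have := (convex_Icc (-|t|) |t|).norm_image_sub_le_of_norm_hasDerivWithin_le
        (f := fun t => A t X) (C := C * (1 + |t|) ^ k)
        (fun s _ => (h.hasDerivAt_apply X s).hasDerivWithinAt)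
        (fun s hs => (hC s).trans (by have := abs_le.mpr hs; gcongr))
        (x := 0) (y := t) (by simp) (abs_le.mp le_rfl)
      simpa [h.map_zero] using this
    have h1 : (1 : ℝ) ≤ (1 + |t|) ^ (k + 1) := one_le_pow₀ (by linarith [abs_nonneg t])
    calc ‖A t X‖ ≤ ‖X‖ + ‖A t X - X‖ := by simpa using norm_add_le X (A t X - X)
      _ ≤ ‖X‖ * (1 + |t|) ^ (k + 1) + C * (1 + |t|) ^ k * (1 + |t|) := by
        gcongr
        · exact le_mul_of_one_le_right (norm_nonneg _) h1
        · exact hmv.trans (by gcongr; linarith)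
      _ = (‖X‖ + C) * (1 + |t|) ^ (k + 1) := by ring

variable [FiniteDimensional ℝ E]

theorem norm_baseChange_apply_eigenvector (h : IsLinearFlow A D) {μ : ℂ} (hμ : μ.re = 0)
    {w : TensorProduct ℝ ℂ E} (hw : (D : E →ₗ[ℝ] E).baseChange ℂ w = μ • w)
    (l : TensorProduct ℝ ℂ E →ₗ[ℂ] ℂ) (t : ℝ) :
    ‖l ((A t : E →ₗ[ℝ] E).baseChange ℂ w)‖ = ‖l w‖ := by
  let L : (E →L[ℝ] E) →ₗ[ℝ] ℂ := ((l ∘ₗ LinearMap.applyₗ w).restrictScalars ℝ) ∘ₗ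
    LinearMap.baseChangeHom ℝ ℂ E E ∘ₗ ContinuousLinearMap.coeLM ℝ
  have hL (T : E →L[ℝ] E) : L T = l ((T : E →ₗ[ℝ] E).baseChange ℂ w) := rfl
  have hmul (T : E →L[ℝ] E) : L (T * D) = μ • L T := by
    have hTD : ((T * D : E →L[ℝ] E) : E →ₗ[ℝ] E).baseChange ℂ
        = (T : E →ₗ[ℝ] E).baseChange ℂ ∘ₗ (D : E →ₗ[ℝ] E).baseChange ℂ :=
      LinearMap.baseChange_comp (A := ℂ) (D : E →ₗ[ℝ] E) (T : E →ₗ[ℝ] E)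
    rw [hL, hL, hTD, LinearMap.comp_apply, hw, map_smul, map_smul]
  have hd (t : ℝ) : HasDerivAt (fun t => L (A t)) (μ • L (A t)) t := by
    rw [← hmul]
    exact L.toContinuousLinearMap.hasFDerivAt.comp_hasDerivAt t (h.hasDerivAt t)
  have hone : L 1 = l w := by
    rw [hL]
    exact congrArg l (LinearMap.congr_fun LinearMap.baseChange_id w)
  rw [← hL, eq_exp_smul_of_hasDerivAt hd t, h.map_zero, hone, norm_smul, ← Complex.exp_eq_exp_ℂ,
    Complex.norm_exp]
  simp [hμ]

theorem exists_norm_baseChange_apply_le (h : IsLinearFlow A D)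
    (hD : IsElliptic (D : Module.End ℝ E)) (l : TensorProduct ℝ ℂ E →ₗ[ℂ] ℂ)
    (w : TensorProduct ℝ ℂ E) :
    ∃ C : ℝ, ∀ t, ‖l ((A t : E →ₗ[ℝ] E).baseChange ℂ w)‖ ≤ C := by
  have hw : w ∈ ⨆ μ : ℂ, Module.End.eigenspace (LinearMap.baseChange ℂ (D : Module.End ℝ E)) μ :=
    iSup_eigenspace_baseChange_eq_top hD.1 ▸ Submodule.mem_top
  induction hw using Submodule.iSup_induction' with
  | zero => exact ⟨0, by simp⟩
  | add x y _ _ hx hy =>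
    obtain ⟨C, hC⟩ := hx
    obtain ⟨C', hC'⟩ := hy
    refine ⟨C + C', fun t => ?_⟩
    simp only [map_add]
    exact norm_add_le_of_le (hC t) (hC' t)
  | mem μ w hw =>
    obtain rfl | h0 := eq_or_ne w 0
    · exact ⟨0, by simp⟩
    · have hμ := hD.2 μ (Module.End.hasEigenvalue_of_hasEigenvector ⟨hw, h0⟩)
      exact ⟨‖l w‖, fun t => (h.norm_baseChange_apply_eigenvector hμ
        (Module.End.mem_eigenspace_iff.mp hw) l t).le⟩

theorem exists_norm_le_of_isElliptic (h : IsLinearFlow A D)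
    (hD : IsElliptic (D : Module.End ℝ E)) : ∃ C : ℝ, ∀ t, ‖A t‖ ≤ C := by
  refine banach_steinhaus fun X => ?_
  let b := Module.finBasis ℝ E
  have hb (i) : ∃ C : ℝ, ∀ t, ‖b.coord i (A t X)‖ ≤ C := by
    obtain ⟨C, hC⟩ := h.exists_norm_baseChange_apply_le hD
      (TensorProduct.AlgebraTensorModule.rid ℝ ℂ ℂ ∘ₗ (b.coord i).baseChange ℂ) (1 ⊗ₜ[ℝ] X)
    exact ⟨C, fun t => by simpa using hC t⟩
  choose C hC using hb
  refine ⟨∑ i, C i * ‖b i‖, fun t => ?_⟩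
  rw [← b.sum_repr (A t X)]
  refine norm_sum_le_of_le _ fun i _ => ?_
  rw [norm_smul]
  exact mul_le_mul_of_nonneg_right (hC i t) (norm_nonneg _)

theorem tendsto_exp_smul_of_isElliptic_of_isNilpotent {A' : ℝ → E →L[ℝ] E} {D' : E →L[ℝ] E}
    (h : IsLinearFlow A D) (hD : IsElliptic (D : Module.End ℝ E)) (h' : IsLinearFlow A' D')
    (hD' : IsNilpotent (D' : Module.End ℝ E)) {r : ℝ} {l : Filter ℝ}
    (hl : Tendsto (fun t => r * t) l atBot) (X : E) :
    Tendsto (fun t => Real.exp (r * t) • A t (A' t X)) l (𝓝 0) := by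
  obtain ⟨C, hC⟩ := h.exists_norm_le_of_isElliptic hD
  obtain ⟨k, hk⟩ := hD'
  have hkX : (D' ^ k) X = 0 := by
    have hpow : ((D' ^ k : E →L[ℝ] E) : E →ₗ[ℝ] E) = (D' : Module.End ℝ E) ^ k :=
      map_pow (ContinuousLinearMap.toLinearMapRingHom : (E →L[ℝ] E) →+* (E →ₗ[ℝ] E)) D' k
    exact LinearMap.congr_fun (hpow.trans hk) X
  obtain ⟨C', hC'⟩ := h'.norm_apply_le_of_pow_apply_eq_zero k hkX
  have hlim := (tendsto_exp_mul_one_add_abs_pow hl k).const_mul (C * C')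
  rw [mul_zero] at hlim
  refine squeeze_zero_norm (fun t => ?_) hlim
  calc ‖Real.exp (r * t) • A t (A' t X)‖ = Real.exp (r * t) * ‖A t (A' t X)‖ := by
        rw [norm_smul, Real.norm_eq_abs, Real.abs_exp]
    _ ≤ Real.exp (r * t) * (C * (C' * (1 + |t|) ^ k)) := by
        gcongr
        exact (A t).le_of_opNorm_le_of_le (hC t) (hC' t)
    _ = C * C' * (Real.exp (r * t) * (1 + |t|) ^ k) := by ring

end IsLinearFlow

end Growth

/-! ### Calculus in the chart at the identity of a Lie group -/

section IdentityChart

variable {E : Type*} [NormedAddCommGroup E]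
  {G : Type*} [TopologicalSpace G] [ChartedSpace E G] [Group G]

variable (E G) in
/-- The preferred chart at the identity of `G`, in which derivatives of maps into `G` are taken. -/
abbrev idChart : OpenPartialHomeomorph G E := chartAt E (1 : G)

theorem one_mem_idChart_source : (1 : G) ∈ (idChart E G).source := mem_chart_source E 1

theorem idChart_one_mem_target : idChart E G 1 ∈ (idChart E G).target :=
  (idChart E G).map_source one_mem_idChart_source

theorem idChart_symm_one : (idChart E G).symm (idChart E G 1) = 1 :=
  (idChart E G).left_inv one_mem_idChart_source

theorem tendsto_idChart_symm : Tendsto (idChart E G).symm (𝓝 (idChart E G 1)) (𝓝 1) := by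
  have h := (idChart E G).continuousAt_symm idChart_one_mem_target
  rwa [ContinuousAt, idChart_symm_one] at h

variable [NormedSpace ℝ E]

theorem hasMFDerivAt_iff_hasDerivAt {c : ℝ → G} {t : ℝ} (hc : c t = 1) (X : E) :
    HasMFDerivAt 𝓘(ℝ, ℝ) 𝓘(ℝ, E) c t ((1 : ℝ →L[ℝ] ℝ).smulRight X : ℝ →L[ℝ] E) ↔
      ContinuousAt c t ∧ HasDerivAt (fun s => idChart E G (c s)) X t := by
  unfold HasMFDerivAt
  refine and_congr_right fun _ => ?_
  rw [hasDerivAt_iff_hasFDerivAt, ← hasFDerivWithinAt_univ]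
  simp only [writtenInExtChartAt, hc, mfld_simps]
  rfl

variable [LieGroup 𝓘(ℝ, E) ∞ G] {F : Type*} [NormedAddCommGroup F] [NormedSpace ℝ F] {y : F}

theorem contDiffAt_idChart_comp {f : F → G} (hf : ContMDiffAt 𝓘(ℝ, F) 𝓘(ℝ, E) ∞ f y)
    (hy : f y ∈ (idChart E G).source) : ContDiffAt ℝ ∞ (fun z => idChart E G (f z)) y := by
  have : IsManifold 𝓘(ℝ, E) ∞ G := ContMDiffMul.toIsManifold
  exact contMDiffAt_iff_contDiffAt.mp
    ((contMDiffAt_of_mem_maximalAtlas (IsManifold.chart_mem_maximalAtlas 1) hy).comp y hf)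

theorem contMDiffAt_idChart_symm_comp {f : F → E} (hf : ContDiffAt ℝ ∞ f y)
    (hy : f y ∈ (idChart E G).target) :
    ContMDiffAt 𝓘(ℝ, F) 𝓘(ℝ, E) ∞ (fun z => (idChart E G).symm (f z)) y := by
  have : IsManifold 𝓘(ℝ, E) ∞ G := ContMDiffMul.toIsManifold
  exact (contMDiffAt_symm_of_mem_maximalAtlas (IsManifold.chart_mem_maximalAtlas 1) hy).comp y
    hf.contMDiffAt

theorem contDiffAt_mul_idChart {x : E} (hx : x ∈ (idChart E G).target) :
    ContDiffAt ℝ ∞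
      (fun p : E × E => idChart E G ((idChart E G).symm p.1 * (idChart E G).symm p.2))
      (x, idChart E G 1) := by
  refine contDiffAt_idChart_comp (.mul (contMDiffAt_idChart_symm_comp contDiffAt_fst hx)
    (contMDiffAt_idChart_symm_comp contDiffAt_snd idChart_one_mem_target)) ?_
  rw [idChart_symm_one, mul_one]
  exact (idChart E G).map_target hx

theorem AutFlow.contMDiffAt_comp_idChart_symm (φ : AutFlow E G) (t : ℝ) :
    ContMDiffAt 𝓘(ℝ, ℝ × E) 𝓘(ℝ, E) ∞ (fun p : ℝ × E => φ p.1 ((idChart E G).symm p.2))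
      (t, idChart E G 1) :=
  φ.contMDiff'.contMDiffAt.comp (t, idChart E G 1) (contDiffAt_fst.contMDiffAt.prodMk
    (contMDiffAt_idChart_symm_comp contDiffAt_snd idChart_one_mem_target))

theorem AutFlow.contDiffAt_idChart (φ : AutFlow E G) (t : ℝ) :
    ContDiffAt ℝ ∞ (fun p : ℝ × E => idChart E G (φ p.1 ((idChart E G).symm p.2)))
      (t, idChart E G 1) := by
  refine contDiffAt_idChart_comp (φ.contMDiffAt_comp_idChart_symm t) ?_
  rw [idChart_symm_one, φ.map_one]
  exact one_mem_idChart_source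

theorem AutFlow.contDiffAt_displacement (φ : AutFlow E G) :
    ContDiffAt ℝ ∞ (fun p : ℝ × E => idChart E G
      (φ p.1 ((idChart E G).symm p.2) * ((idChart E G).symm p.2)⁻¹)) (0, idChart E G 1) := by
  refine contDiffAt_idChart_comp ((φ.contMDiffAt_comp_idChart_symm 0).mul
    (contMDiffAt_idChart_symm_comp contDiffAt_snd idChart_one_mem_target).inv) ?_
  rw [idChart_symm_one, φ.map_one, inv_one, mul_one]
  exact one_mem_idChart_source

end IdentityChart

/-! ### The differential at the identity of a flow of automorphisms -/

namespace AutFlow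

variable {E : Type*} [NormedAddCommGroup E] [NormedSpace ℝ E]
  {G : Type*} [TopologicalSpace G] [ChartedSpace E G] [Group G]

/-- The differential `(dφ_t)_e`, as an endomorphism of the model space `E`. -/
def differential (φ : AutFlow E G) (t : ℝ) : E →L[ℝ] E :=
  mfderiv 𝓘(ℝ, E) 𝓘(ℝ, E) (φ t) (1 : G)

theorem contMDiff_apply (φ : AutFlow E G) (t : ℝ) :
    ContMDiff 𝓘(ℝ, E) 𝓘(ℝ, E) ∞ (φ t) :=
  φ.contMDiff'.comp (contMDiff_const.prodMk contMDiff_id)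

theorem contMDiff_orbit (φ : AutFlow E G) (g : G) :
    ContMDiff 𝓘(ℝ, ℝ) 𝓘(ℝ, E) ∞ (fun t => φ t g) :=
  φ.contMDiff'.comp (contMDiff_id.prodMk contMDiff_const)

theorem isAutFlow (φ : AutFlow E G) : IsAutFlow φ.toFun where
  continuous := φ.contMDiff'.continuous
  map_mul := φ.map_mul'
  map_zero := φ.map_zero'
  map_add := φ.map_add'

theorem hasMFDerivAt (φ : AutFlow E G) (t : ℝ) :
    HasMFDerivAt 𝓘(ℝ, E) 𝓘(ℝ, E) (φ t) (1 : G) (φ.differential t) :=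
  ((φ.contMDiff_apply t).mdifferentiableAt (by simp)).hasMFDerivAt

theorem hasFDerivAt_idChart (φ : AutFlow E G) (t : ℝ) :
    HasFDerivAt (fun x => idChart E G (φ t ((idChart E G).symm x))) (φ.differential t)
      (idChart E G 1) := by
  have h := (φ.hasMFDerivAt t).2
  rw [← hasFDerivWithinAt_univ]
  simp only [writtenInExtChartAt, φ.map_one, mfld_simps] at h
  exact h

theorem differential_zero (φ : AutFlow E G) : φ.differential 0 = 1 := by
  have : φ.toFun 0 = id := funext φ.map_zero'
  rw [differential, this]
  exact mfderiv_id

theorem hasMFDerivAt_comp (φ : AutFlow E G) (t : ℝ) {f : G → G} {L : E →L[ℝ] E}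
    (hf : HasMFDerivAt 𝓘(ℝ, E) 𝓘(ℝ, E) f (1 : G) L) (hf1 : f 1 = 1) :
    HasMFDerivAt 𝓘(ℝ, E) 𝓘(ℝ, E) (φ t ∘ f) (1 : G) (φ.differential t * L) :=
  HasMFDerivAt.comp (1 : G) (hf1.symm ▸ φ.hasMFDerivAt t) hf

theorem differential_add (φ : AutFlow E G) (s t : ℝ) :
    φ.differential (s + t) = φ.differential s * φ.differential t := by
  have hcomp := φ.hasMFDerivAt_comp s (φ.hasMFDerivAt t) (φ.map_one t)
  rw [← (funext (φ.map_add' s t) : φ.toFun (s + t) = φ.toFun s ∘ φ.toFun t)] at hcomp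
  exact hasMFDerivAt_unique (φ.hasMFDerivAt (s + t)) hcomp

variable [LieGroup 𝓘(ℝ, E) ∞ G]

theorem differentiableAt_differential_zero (φ : AutFlow E G) :
    DifferentiableAt ℝ φ.differential 0 := by
  have hd : DifferentiableAt ℝ (fun t : ℝ => (fderiv ℝ (fun p : ℝ × E =>
      idChart E G (φ p.1 ((idChart E G).symm p.2))) (t, idChart E G 1)).comp
        (ContinuousLinearMap.inr ℝ ℝ E)) 0 := by
    refine .clm_comp (.comp (0 : ℝ) ?_ (by fun_prop)) (differentiableAt_const _)
    exact ((φ.contDiffAt_idChart 0).fderiv_right (m := 1)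
      (by rw [one_add_one_eq_two]; exact ENat.LEInfty.out)).differentiableAt one_ne_zero
  convert hd using 1
  ext1 t
  exact (φ.hasFDerivAt_idChart t).unique
    (((φ.contDiffAt_idChart t).differentiableAt (by simp)).hasFDerivAt.comp
      (idChart E G 1) (hasFDerivAt_prodMk_right t (idChart E G 1)))

theorem isLinearFlow_differential (φ : AutFlow E G) :
    IsLinearFlow φ.differential (deriv φ.differential 0) where
  map_zero := φ.differential_zero
  hasDerivAt t := by
    have hcomp : φ.differential = fun s => φ.differential t * φ.differential (s - t) :=
      funext fun s => by rw [← φ.differential_add, add_sub_cancel]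
    have hshift : HasDerivAt (fun s => φ.differential (s - t)) (deriv φ.differential 0) t :=
      .comp_sub_const t t (by simpa using φ.differentiableAt_differential_zero.hasDerivAt)
    have hmul := hshift.const_mul (φ.differential t)
    rwa [← hcomp] at hmul

end AutFlow

/-! ### One-parameter subgroups -/

section OneParameter

variable {E : Type*} [NormedAddCommGroup E] [NormedSpace ℝ E]
  {G : Type*} [TopologicalSpace G] [ChartedSpace E G] [Group G]

theorem comp_one_smulRight (L : E →L[ℝ] E) (X : E) :
    L.comp ((1 : ℝ →L[ℝ] ℝ).smulRight X) = (1 : ℝ →L[ℝ] ℝ).smulRight (L X) := by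
  ext
  simp

theorem map_zero_of_map_add {M : Type*} [Group M] {γ : ℝ → M}
    (h : ∀ s t, γ (s + t) = γ s * γ t) : γ 0 = 1 := by
  simpa using h 0 0

/-- A homomorphism `γ : ℝ → G` with `γ'(0) = X`, so that `γ t = exp (t X)`. Unlike in
`IsOneParameterSubgroup`, differentiability is required only at `0`, and is read in the chart at
the identity. -/
structure HasGenerator (γ : ℝ → G) (X : E) : Prop where
  map_add : ∀ s t, γ (s + t) = γ s * γ t
  continuousAt_zero : ContinuousAt γ 0
  hasDerivAt_zero : HasDerivAt (fun s => idChart E G (γ s)) X 0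

namespace HasGenerator

variable {γ : ℝ → G} {X : E}

theorem map_zero (h : HasGenerator γ X) : γ 0 = 1 := map_zero_of_map_add h.map_add

theorem hasMFDerivAt_zero (h : HasGenerator γ X) :
    HasMFDerivAt 𝓘(ℝ, ℝ) 𝓘(ℝ, E) γ 0 ((1 : ℝ →L[ℝ] ℝ).smulRight X : ℝ →L[ℝ] E) :=
  (hasMFDerivAt_iff_hasDerivAt h.map_zero X).mpr ⟨h.continuousAt_zero, h.hasDerivAt_zero⟩

theorem comp_mul (h : HasGenerator γ X) (c : ℝ) : HasGenerator (fun s => γ (c * s)) (c • X) where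
  map_add s t := by rw [mul_add, h.map_add]
  continuousAt_zero := by
    refine ContinuousAt.comp (g := γ) (f := fun s => c * s) ?_ (by fun_prop)
    rw [mul_zero]
    exact h.continuousAt_zero
  hasDerivAt_zero := by
    refine HasDerivAt.scomp (0 : ℝ) (g₁ := fun s => idChart E G (γ s)) (h := fun s => c * s) ?_
      (hasDerivAt_const_mul c)
    rw [mul_zero]
    exact h.hasDerivAt_zero

theorem comp_flow (h : HasGenerator γ X) (φ : AutFlow E G) (t : ℝ) :
    HasGenerator (fun s => φ t (γ s)) (φ.differential t X) := by
  have hφ : HasMFDerivAt 𝓘(ℝ, E) 𝓘(ℝ, E) (φ t) (γ 0) (φ.differential t) := by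
    rw [h.map_zero]
    exact φ.hasMFDerivAt t
  obtain ⟨hc, hd⟩ := (hasMFDerivAt_iff_hasDerivAt (by simp [h.map_zero, φ.map_one]) _).mp
    ((hφ.comp 0 h.hasMFDerivAt_zero).congr_mfderiv (comp_one_smulRight (E := E) _ X))
  exact ⟨fun s r => by rw [h.map_add, φ.map_mul'], hc, hd⟩

end HasGenerator

theorem IsOneParameterSubgroup.hasGenerator {γ : ℝ → G} {X : E}
    (h : IsOneParameterSubgroup (E := E) γ X) : HasGenerator γ X := by
  have hd : MDifferentiableAt 𝓘(ℝ, ℝ) 𝓘(ℝ, E) γ 0 := h.contMDiff.mdifferentiableAt (by simp)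
  have hX : (mfderiv 𝓘(ℝ, ℝ) 𝓘(ℝ, E) γ 0 : ℝ →L[ℝ] E)
      = ((1 : ℝ →L[ℝ] ℝ).smulRight X : ℝ →L[ℝ] E) :=
    ContinuousLinearMap.ext_ring (h.deriv_zero.trans (one_smul ℝ X).symm)
  obtain ⟨hcont, hderiv⟩ := (hasMFDerivAt_iff_hasDerivAt (map_zero_of_map_add h.map_add) X).mp
    (hd.hasMFDerivAt.congr_mfderiv hX)
  exact ⟨h.map_add, hcont, hderiv⟩

variable [LieGroup 𝓘(ℝ, E) ∞ G]

variable (E) in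
theorem mdifferentiableAt_mul_left (g h : G) :
    MDifferentiableAt 𝓘(ℝ, E) 𝓘(ℝ, E) (g * ·) h :=
  (contMDiff_mul_left (I := 𝓘(ℝ, E)) (n := ∞)).mdifferentiableAt (by simp)

theorem mfderiv_mul_left_mulInvariantVectorField (g h : G) (X : GroupLieAlgebra 𝓘(ℝ, E) G) :
    mfderiv 𝓘(ℝ, E) 𝓘(ℝ, E) (g * ·) h (mulInvariantVectorField X h)
      = mulInvariantVectorField X (g * h) := by
  have hg : HasMFDerivAt 𝓘(ℝ, E) 𝓘(ℝ, E) (g * ·) (h * 1)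
      (mfderiv 𝓘(ℝ, E) 𝓘(ℝ, E) (g * ·) h : E →L[ℝ] E) := by
    rw [mul_one]
    exact (mdifferentiableAt_mul_left E g h).hasMFDerivAt
  have hcomp := hg.comp (1 : G) (mdifferentiableAt_mul_left E h 1).hasMFDerivAt
  rw [comp_mul_left] at hcomp
  exact (DFunLike.congr_fun
    (hasMFDerivAt_unique (mdifferentiableAt_mul_left E (g * h) 1).hasMFDerivAt hcomp) X).symm

theorem isMIntegralCurveOn_mul_left {γ : ℝ → G} {X : GroupLieAlgebra 𝓘(ℝ, E) G} {s : Set ℝ}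
    (h : IsMIntegralCurveOn γ (mulInvariantVectorField X) s) (g : G) :
    IsMIntegralCurveOn (fun t => g * γ t) (mulInvariantVectorField X) s := by
  intro t ht
  refine ((mdifferentiableAt_mul_left E g (γ t)).hasMFDerivAt.comp_hasMFDerivWithinAt t
    (h t ht)).congr_mfderiv ?_
  rw [← mfderiv_mul_left_mulInvariantVectorField]
  exact comp_one_smulRight (E := E) _ _

theorem contMDiff_mulInvariantVectorField_one (X : GroupLieAlgebra 𝓘(ℝ, E) G) :
    ContMDiff 𝓘(ℝ, E) 𝓘(ℝ, E).tangent 1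
      (fun g : G => (⟨g, mulInvariantVectorField X g⟩ : TangentBundle 𝓘(ℝ, E) G)) := by
  have : LieGroup 𝓘(ℝ, E) (minSmoothness ℝ 3) G :=
    LieGroup.of_le (n := ∞) (by rw [minSmoothness_of_isRCLikeNormedField]; exact ENat.LEInfty.out)
  exact (contMDiff_mulInvariantVectorField X).of_le (by simp)

theorem HasGenerator.isMIntegralCurve {γ : ℝ → G} {X : E} (h : HasGenerator γ X) :
    IsMIntegralCurve γ (mulInvariantVectorField (I := 𝓘(ℝ, E)) (G := G) X) := by
  intro t
  have hγ : γ = (γ t * ·) ∘ γ ∘ fun s => s - t := by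
    funext s
    simp [← h.map_add]
  have hsub : HasMFDerivAt 𝓘(ℝ, ℝ) 𝓘(ℝ, ℝ) (fun s : ℝ => s - t) t (1 : ℝ →L[ℝ] ℝ) :=
    ((hasFDerivAt_id t).sub_const t).hasMFDerivAt
  have hzero : HasMFDerivAt 𝓘(ℝ, ℝ) 𝓘(ℝ, E) γ (t - t)
      ((1 : ℝ →L[ℝ] ℝ).smulRight X : ℝ →L[ℝ] E) := by
    rw [sub_self]
    exact h.hasMFDerivAt_zero
  have hmul : HasMFDerivAt 𝓘(ℝ, E) 𝓘(ℝ, E) (γ t * ·) (γ (t - t))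
      (mfderiv 𝓘(ℝ, E) 𝓘(ℝ, E) (γ t * ·) (1 : G) : E →L[ℝ] E) := by
    rw [sub_self, h.map_zero]
    exact (mdifferentiableAt_mul_left E (γ t) 1).hasMFDerivAt
  have hcomp := hmul.comp t (HasMFDerivAt.comp (f := fun s => s - t) t hzero hsub)
  exact (hcomp.congr_of_eventuallyEq (.of_forall (congrFun hγ))).congr_mfderiv
    (comp_one_smulRight (E := E) _ X)

variable [T2Space G]

theorem HasGenerator.unique {γ γ' : ℝ → G} {X : E} (h : HasGenerator γ X)
    (h' : HasGenerator γ' X) : γ = γ' := by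
  have : IsManifold 𝓘(ℝ, E) 1 G := IsManifold.of_le (n := ∞) ENat.LEInfty.out
  exact isMIntegralCurve_Ioo_eq_of_contMDiff_boundaryless (t₀ := 0)
    (contMDiff_mulInvariantVectorField_one X) h.isMIntegralCurve h'.isMIntegralCurve
    (by rw [h.map_zero, h'.map_zero])

theorem hasGenerator_of_isMIntegralCurve {γ : ℝ → G} {X : E} (h0 : γ 0 = 1)
    (h : IsMIntegralCurve γ (mulInvariantVectorField (I := 𝓘(ℝ, E)) (G := G) X)) :
    HasGenerator γ X := by
  have : IsManifold 𝓘(ℝ, E) 1 G := IsManifold.of_le (n := ∞) ENat.LEInfty.out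
  have hX : (mulInvariantVectorField (I := 𝓘(ℝ, E)) (G := G) X (γ 0) : E) = X := by
    have hid : ((1 : G) * ·) = id := funext one_mul
    rw [h0]
    unfold mulInvariantVectorField
    rw [hid, mfderiv_id]
    rfl
  obtain ⟨hc, hd⟩ := (hasMFDerivAt_iff_hasDerivAt h0 X).mp
    ((h 0).congr_mfderiv (congrArg (fun Y : E => (1 : ℝ →L[ℝ] ℝ).smulRight Y) hX))
  refine ⟨fun s t => ?_, hc, hd⟩
  have hmul : IsMIntegralCurve (fun t => γ s * γ t) (mulInvariantVectorField X) :=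
    isMIntegralCurve_iff_isMIntegralCurveOn.mpr
      (isMIntegralCurveOn_mul_left (h.isMIntegralCurveOn univ) (γ s))
  have heq := isMIntegralCurve_Ioo_eq_of_contMDiff_boundaryless (t₀ := 0)
    (contMDiff_mulInvariantVectorField_one X) (h.comp_add s) hmul (by simp [h0])
  simpa [add_comm] using congrFun heq t

theorem exists_hasGenerator [CompleteSpace E] (X : E) : ∃ γ : ℝ → G, HasGenerator γ X := by
  have : IsManifold 𝓘(ℝ, E) 1 G := IsManifold.of_le (n := ∞) ENat.LEInfty.out
  have hv := contMDiff_mulInvariantVectorField_one (E := E) (G := G) X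
  obtain ⟨γ₀, h0, hγ₀⟩ :=
    exists_isMIntegralCurveAt_of_contMDiffAt_boundaryless (t₀ := 0) (hv.contMDiffAt (x := (1 : G)))
  obtain ⟨ε, hε, hγ₀⟩ := isMIntegralCurveAt_iff'.mp hγ₀
  rw [Real.ball_eq_Ioo, zero_sub, zero_add] at hγ₀
  -- Left translates of `γ₀` are integral curves of the same length through any given point.
  obtain ⟨γ, hγ0, hγ⟩ := exists_isMIntegralCurve_of_isMIntegralCurveOn hv hε
    (fun g => ⟨fun t => g * γ₀ t, by simp [h0], isMIntegralCurveOn_mul_left hγ₀ g⟩) 1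
  exact ⟨γ, hasGenerator_of_isMIntegralCurve hγ0 hγ⟩

end OneParameter

/-! ### Uniform estimates on one-parameter subgroups -/

section Estimates

theorem forall_mem_Icc_of_isClosed_subset_isOpen {K : Type*} [TopologicalSpace K] {γ : ℝ → K}
    (hγ : Continuous γ) {O B : Set K} (hO : IsOpen O) (hB : IsClosed B) (hBO : B ⊆ O)
    (h0 : γ 0 ∈ O) {a : ℝ} (h : ∀ u ∈ Icc 0 a, (∀ s ∈ Icc 0 u, γ s ∈ O) → γ u ∈ B) :
    ∀ s ∈ Icc 0 a, γ s ∈ O := by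
  by_contra! hexit
  obtain ⟨u, ⟨hu, huO⟩, hleast⟩ := (isCompact_Icc.inter_right
    (hO.isClosed_compl.preimage hγ) : IsCompact (Icc 0 a ∩ γ ⁻¹' Oᶜ)).exists_isLeast hexit
  have hbefore : ∀ s ∈ Ico 0 u, γ s ∈ O := fun s hs => by
    by_contra hsO
    exact (hleast ⟨⟨hs.1, hs.2.le.trans hu.2⟩, hsO⟩).not_gt hs.2
  have hu0 : 0 ≠ u := fun hu0 => huO (hu0 ▸ h0)
  have hclosed : closure (Ico 0 u) ⊆ γ ⁻¹' B :=
    closure_minimal (fun s hs => h s ⟨hs.1, hs.2.le.trans hu.2⟩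
      fun v hv => hbefore v ⟨hv.1, hv.2.trans_lt hs.2⟩) (hB.preimage hγ)
  rw [closure_Ico hu0] at hclosed
  exact huO (hBO (hclosed (right_mem_Icc.mpr hu.1)))

variable {E : Type*} [NormedAddCommGroup E] [NormedSpace ℝ E]
  {G : Type*} [TopologicalSpace G] [ChartedSpace E G] [Group G]

variable (E G) in
/-- The derivative at the identity of the left translation by the point with coordinate `x`. -/
def leftDeriv (x : E) : E →L[ℝ] E :=
  fderiv ℝ (fun y => idChart E G ((idChart E G).symm x * (idChart E G).symm y)) (idChart E G 1)

variable [LieGroup 𝓘(ℝ, E) ∞ G]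

theorem hasFDerivAt_mul_idChart {x : E} (hx : x ∈ (idChart E G).target) :
    HasFDerivAt (fun y => idChart E G ((idChart E G).symm x * (idChart E G).symm y))
      ((fderiv ℝ (fun p : E × E => idChart E G ((idChart E G).symm p.1 * (idChart E G).symm p.2))
        (x, idChart E G 1)).comp (ContinuousLinearMap.inr ℝ E E)) (idChart E G 1) :=
  ((contDiffAt_mul_idChart hx).differentiableAt (by simp)).hasFDerivAt.comp
    (idChart E G 1) (hasFDerivAt_prodMk_right x (idChart E G 1))

theorem hasFDerivAt_leftDeriv {x : E} (hx : x ∈ (idChart E G).target) :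
    HasFDerivAt (fun y => idChart E G ((idChart E G).symm x * (idChart E G).symm y))
      (leftDeriv E G x) (idChart E G 1) :=
  (hasFDerivAt_mul_idChart hx).differentiableAt.hasFDerivAt

theorem continuousAt_leftDeriv : ContinuousAt (leftDeriv E G) (idChart E G 1) := by
  have hfd := ((contDiffAt_mul_idChart (E := E) (G := G) idChart_one_mem_target).fderiv_right
    (m := 0) (by simp)).continuousAt
  refine ((hfd.comp (f := fun x : E => (x, idChart E G 1)) (by fun_prop)).clm_comp
    (continuousAt_const (y := ContinuousLinearMap.inr ℝ E E))).congr ?_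
  filter_upwards [(idChart E G).open_target.mem_nhds idChart_one_mem_target] with x hx
  exact (hasFDerivAt_mul_idChart hx).fderiv.symm

namespace HasGenerator

variable {γ : ℝ → G} {X : E}

theorem continuous (h : HasGenerator γ X) : Continuous γ :=
  continuous_iff_continuousAt.mpr fun t => (h.isMIntegralCurve t).continuousAt

theorem eventually_mem_idChart_source (h : HasGenerator γ X) :
    ∀ᶠ s in 𝓝 (0 : ℝ), γ s ∈ (idChart E G).source :=
  h.continuous.continuousAt.eventually_mem (by rw [h.map_zero]; exact chart_source_mem_nhds E 1)

theorem hasDerivAt (h : HasGenerator γ X) {s : ℝ} (hs : γ s ∈ (idChart E G).source) :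
    HasDerivAt (fun s => idChart E G (γ s)) (leftDeriv E G (idChart E G (γ s)) X) s := by
  have hleft := hasFDerivAt_leftDeriv ((idChart E G).map_source hs)
  rw [(idChart E G).left_inv hs, ← h.map_zero] at hleft
  have hcomp := hleft.comp_hasDerivAt (0 : ℝ) (f := fun r => idChart E G (γ r)) h.hasDerivAt_zero
  have hshift : HasDerivAt (fun r => idChart E G (γ (s + r)))
      (leftDeriv E G (idChart E G (γ s)) X) (s - s) := by
    rw [sub_self]
    refine hcomp.congr_of_eventuallyEq ?_
    filter_upwards [h.eventually_mem_idChart_source] with r hr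
    simp [(idChart E G).left_inv hr, h.map_add]
  simpa using hshift.comp_sub_const s s

theorem hasStrictDerivAt_zero (h : HasGenerator γ X) :
    HasStrictDerivAt (fun s => idChart E G (γ s)) X 0 := by
  have hc : ContinuousAt (fun s => leftDeriv E G (idChart E G (γ s)) X) 0 := by
    refine ContinuousAt.clm_apply (ContinuousAt.comp (g := leftDeriv E G) ?_
      h.hasDerivAt_zero.continuousAt) continuousAt_const
    rw [h.map_zero]
    exact continuousAt_leftDeriv
  have hstrict := hasStrictDerivAt_of_hasDerivAt_of_continuousAt
    (h.eventually_mem_idChart_source.mono fun s hs => h.hasDerivAt hs) hc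
  rwa [← h.hasDerivAt_zero.unique hstrict.hasDerivAt] at hstrict

theorem norm_idChart_sub_le (h : HasGenerator γ X) {M u : ℝ} (hu : 0 ≤ u)
    (hγ : ∀ s ∈ Icc 0 u, γ s ∈ (idChart E G).source ∧ ‖leftDeriv E G (idChart E G (γ s))‖ ≤ M) :
    ‖idChart E G (γ u) - idChart E G 1‖ ≤ M * ‖X‖ * u := by
  have hmv := norm_image_sub_le_of_norm_deriv_le_segment' (f := fun s => idChart E G (γ s))
    (fun s hs => (h.hasDerivAt (hγ s hs).1).hasDerivWithinAt)
    (fun s hs => ContinuousLinearMap.le_of_opNorm_le _ (hγ s ⟨hs.1, hs.2.le⟩).2 X)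
    u (right_mem_Icc.mpr hu)
  simpa [h.map_zero] using hmv

end HasGenerator

variable [FiniteDimensional ℝ E] [T2Space G]

theorem exists_generator_bound_Icc {V : Set G} (hV : V ∈ 𝓝 1) :
    ∃ δ > 0, ∀ (γ : ℝ → G) (X : E), HasGenerator γ X → ‖X‖ < δ → ∀ s ∈ Icc (0 : ℝ) 1,
      γ s ∈ V := by
  set x₀ := idChart E G 1 with hx₀
  set M : ℝ := ‖leftDeriv E G x₀‖ + 1 with hM
  have hev : ∀ᶠ x in 𝓝 x₀, x ∈ (idChart E G).target ∧ (idChart E G).symm x ∈ V ∧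
      ‖leftDeriv E G x‖ < M :=
    Eventually.and ((idChart E G).open_target.mem_nhds idChart_one_mem_target)
      ((tendsto_idChart_symm.eventually_mem hV).and
        (continuousAt_leftDeriv.norm.eventually_lt continuousAt_const (by simp [hM, hx₀])))
  obtain ⟨r, hr, hball⟩ := Metric.nhds_basis_ball.eventually_iff.mp hev
  have hsmall : Metric.closedBall x₀ (r / 2) ⊆ Metric.ball x₀ r :=
    Metric.closedBall_subset_ball (by linarith)
  set O : Set G := (idChart E G).source ∩ idChart E G ⁻¹' Metric.ball x₀ r
  set B : Set G := (idChart E G).symm '' Metric.closedBall x₀ (r / 2)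
  have hBclosed : IsClosed B :=
    ((isCompact_closedBall x₀ (r / 2)).image_of_continuousOn
      ((idChart E G).continuousOn_symm.mono fun x hx => (hball (hsmall hx)).1)).isClosed
  have hBO : B ⊆ O := by
    rintro _ ⟨x, hx, rfl⟩
    have hxt := (hball (hsmall hx)).1
    exact ⟨(idChart E G).map_target hxt, by
      rw [mem_preimage, (idChart E G).right_inv hxt]; exact hsmall hx⟩
  refine ⟨r / (2 * M), by positivity, fun γ X h hX s hs => ?_⟩
  have hXM : M * ‖X‖ ≤ r / 2 := by
    rw [lt_div_iff₀ (by positivity)] at hX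
    linarith
  have hstay : ∀ s ∈ Icc 0 1, γ s ∈ O := by
    refine forall_mem_Icc_of_isClosed_subset_isOpen h.continuous
      ((idChart E G).isOpen_inter_preimage Metric.isOpen_ball) hBclosed hBO
      (by rw [h.map_zero]; exact ⟨one_mem_idChart_source, Metric.mem_ball_self hr⟩)
      fun u hu hγ => ⟨idChart E G (γ u), ?_, (idChart E G).left_inv (hγ u ⟨hu.1, le_rfl⟩).1⟩
    rw [mem_closedBall_iff_norm]
    calc ‖idChart E G (γ u) - x₀‖
        ≤ M * ‖X‖ * u :=
          h.norm_idChart_sub_le hu.1 fun v hv => ⟨(hγ v hv).1, (hball (hγ v hv).2).2.2.le⟩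
      _ ≤ M * ‖X‖ := mul_le_of_le_one_right (by positivity) hu.2
      _ ≤ r / 2 := hXM
  rw [← (idChart E G).left_inv (hstay s hs).1]
  exact (hball (hstay s hs).2).2.1

theorem exists_generator_bound {V : Set G} (hV : V ∈ 𝓝 1) :
    ∃ δ > 0, ∀ (γ : ℝ → G) (X : E), HasGenerator γ X → ‖X‖ < δ → ∀ s : ℝ, |s| ≤ 1 → γ s ∈ V := by
  obtain ⟨δ, hδ, hbound⟩ := exists_generator_bound_Icc (E := E) hV
  refine ⟨δ, hδ, fun γ X h hX s hs => ?_⟩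
  have hsign : ‖(SignType.sign s : ℝ) • X‖ ≤ ‖X‖ := by
    rw [norm_smul]
    refine mul_le_of_le_one_left (norm_nonneg _) ?_
    rcases SignType.sign s with _ | _ | _ <;> simp
  simpa only [sign_mul_abs] using
    hbound _ _ (h.comp_mul (SignType.sign s : ℝ)) (hsign.trans_lt hX) |s| ⟨abs_nonneg s, hs⟩

end Estimates

/-! ### Coordinates of the second kind -/

section SecondKind

variable {G : Type*} [Group G] {ι : Type*}

/-- The ordered product `∏ γ_i(s_i)` over the list `L`: coordinates of the second kind with respect
to the one-parameter subgroups `γ_i`. -/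
def curveProd (γ : ι → ℝ → G) (L : List ι) (s : ι → ℝ) : G :=
  (L.map fun i => γ i (s i)).prod

theorem curveProd_cons (γ : ι → ℝ → G) (i : ι) (L : List ι) (s : ι → ℝ) :
    curveProd γ (i :: L) s = γ i (s i) * curveProd γ L s := by
  simp [curveProd]

theorem curveProd_append (γ : ι → ℝ → G) (L L' : List ι) (s : ι → ℝ) :
    curveProd γ (L ++ L') s = curveProd γ L s * curveProd γ L' s := by
  simp [curveProd]

theorem curveProd_mem {γ : ι → ℝ → G} {L : List ι} {H : Subgroup G}
    (h : ∀ i ∈ L, ∀ r, γ i r ∈ H) (s : ι → ℝ) : curveProd γ L s ∈ H :=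
  H.list_prod_mem fun x hx => by
    obtain ⟨i, hi, rfl⟩ := List.mem_map.mp hx
    exact h i hi _

variable {E : Type*} [NormedAddCommGroup E] [NormedSpace ℝ E] [TopologicalSpace G]
  [ChartedSpace E G] {γ : ι → ℝ → G} {X : ι → E}

theorem curveProd_zero (h : ∀ i, HasGenerator (γ i) (X i)) (L : List ι) :
    curveProd γ L 0 = 1 := by
  simp [curveProd, (h _).map_zero]

variable [LieGroup 𝓘(ℝ, E) ∞ G]

theorem continuous_curveProd (h : ∀ i, HasGenerator (γ i) (X i)) (L : List ι) :
    Continuous (curveProd γ L) := by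
  have : IsTopologicalGroup G := topologicalGroup_of_lieGroup 𝓘(ℝ, E) ∞
  exact continuous_list_prod L fun i _ => (h i).continuous.comp (continuous_apply i)

theorem hasStrictFDerivAt_mul_idChart :
    HasStrictFDerivAt
      (fun p : E × E => idChart E G ((idChart E G).symm p.1 * (idChart E G).symm p.2))
      (ContinuousLinearMap.fst ℝ E E + ContinuousLinearMap.snd ℝ E E)
      (idChart E G 1, idChart E G 1) := by
  have hmul := (contDiffAt_mul_idChart (E := E) (G := G) idChart_one_mem_target).hasStrictFDerivAt
    (by simp)
  have hright_inv : ∀ᶠ x in 𝓝 (idChart E G 1), idChart E G ((idChart E G).symm x) = x :=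
    (idChart E G).eventually_right_inverse idChart_one_mem_target
  refine hmul.congr_fderiv (ContinuousLinearMap.prod_ext ?_ ?_)
  · rw [ContinuousLinearMap.add_comp, ContinuousLinearMap.fst_comp_inl,
      ContinuousLinearMap.snd_comp_inl, add_zero]
    refine (hmul.hasFDerivAt.comp (f := fun x => (x, idChart E G 1)) _
      (hasFDerivAt_prodMk_left _ _)).unique
      ((hasFDerivAt_id (idChart E G 1)).congr_of_eventuallyEq ?_)
    filter_upwards [hright_inv] with x hx
    simp [hx]
  · rw [ContinuousLinearMap.add_comp, ContinuousLinearMap.fst_comp_inr,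
      ContinuousLinearMap.snd_comp_inr, zero_add]
    refine (hmul.hasFDerivAt.comp _ (hasFDerivAt_prodMk_right _ _)).unique
      ((hasFDerivAt_id (idChart E G 1)).congr_of_eventuallyEq ?_)
    filter_upwards [hright_inv] with x hx
    simp [hx]

theorem hasStrictFDerivAt_idChart_mul {F : Type*} [NormedAddCommGroup F] [NormedSpace ℝ F]
    {a b : F → G} {a' b' : F →L[ℝ] E} {y : F} (ha1 : a y = 1) (hb1 : b y = 1)
    (hac : ContinuousAt a y) (hbc : ContinuousAt b y)
    (ha : HasStrictFDerivAt (fun z => idChart E G (a z)) a' y)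
    (hb : HasStrictFDerivAt (fun z => idChart E G (b z)) b' y) :
    HasStrictFDerivAt (fun z => idChart E G (a z * b z)) (a' + b') y := by
  have hsource : (idChart E G).source ∈ 𝓝 (1 : G) := chart_source_mem_nhds E (1 : G)
  refine (HasStrictFDerivAt.comp y (f := fun z => (idChart E G (a z), idChart E G (b z)))
    (by simpa only [ha1, hb1] using hasStrictFDerivAt_mul_idChart (E := E) (G := G))
    (ha.prodMk hb)).congr_of_eventuallyEq ?_
  filter_upwards [hac.eventually_mem (ha1.symm ▸ hsource), hbc.eventually_mem (hb1.symm ▸ hsource)]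
    with z hza hzb
  simp only [(idChart E G).left_inv hza, (idChart E G).left_inv hzb]

theorem hasStrictFDerivAt_curveProd [Finite ι] (h : ∀ i, HasGenerator (γ i) (X i)) (L : List ι) :
    HasStrictFDerivAt (fun s : ι → ℝ => idChart E G (curveProd γ L s))
      (L.map fun i => (ContinuousLinearMap.proj (R := ℝ) (φ := fun _ : ι => ℝ) i).smulRight
        (X i)).sum 0 := by
  cases nonempty_fintype ι
  induction L with
  | nil =>
    simp only [curveProd, List.map_nil, List.prod_nil, List.sum_nil]
    exact hasStrictFDerivAt_const _ _
  | cons i L ih =>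
    have hi : HasStrictFDerivAt (fun s : ι → ℝ => idChart E G (γ i (s i)))
        ((ContinuousLinearMap.proj (R := ℝ) (φ := fun _ : ι => ℝ) i).smulRight (X i)) 0 :=
      ((h i).hasStrictDerivAt_zero.hasStrictFDerivAt.comp (0 : ι → ℝ) (f := fun s : ι → ℝ => s i)
        (ContinuousLinearMap.proj (R := ℝ) (φ := fun _ : ι => ℝ) i).hasStrictFDerivAt).congr_fderiv
        (ContinuousLinearMap.ext fun _ => by simp)
    simp only [curveProd_cons, List.map_cons, List.sum_cons]
    exact hasStrictFDerivAt_idChart_mul (h i).map_zero (curveProd_zero h L)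
      ((h i).continuous.comp (continuous_apply i)).continuousAt
      (continuous_curveProd h L).continuousAt hi ih

theorem nhds_one_le_map_curveProd [Finite ι] [FiniteDimensional ℝ E] (b : Module.Basis ι ℝ E)
    (h : ∀ i, HasGenerator (γ i) (b i)) {L : List ι} (hL : L.Nodup) (hmem : ∀ i, i ∈ L) :
    𝓝 1 ≤ map (curveProd γ L) (𝓝 0) := by
  classical
  cases nonempty_fintype ι
  have hsurj : (L.map fun i => (ContinuousLinearMap.proj (R := ℝ) (φ := fun _ : ι => ℝ) i).smulRight
      (b i)).sum.range = ⊤ := by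
    refine LinearMap.range_eq_top.mpr fun e => ⟨fun i => b.repr e i, ?_⟩
    rw [← List.sum_toFinset _ hL, show L.toFinset = Finset.univ by ext i; simp [hmem i]]
    simp [b.sum_repr]
  have hopen := (hasStrictFDerivAt_curveProd h L).map_nhds_eq_of_surj hsurj
  rw [curveProd_zero h] at hopen
  have hsource := chart_source_mem_nhds E (1 : G)
  intro A hA
  have hA' : curveProd γ L ⁻¹' (A ∩ (idChart E G).source) ∈ 𝓝 (0 : ι → ℝ) :=
    inter_mem hA ((continuous_curveProd h L).continuousAt.preimage_mem_nhds
      (by rwa [curveProd_zero h]))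
  have himage := image_mem_map (m := fun s : ι → ℝ => idChart E G (curveProd γ L s)) hA'
  rw [hopen] at himage
  filter_upwards [(idChart E G).continuousAt one_mem_idChart_source |>.preimage_mem_nhds himage,
    hsource] with g ⟨s, ⟨hsA, hss⟩, hs⟩ hg
  rwa [← (idChart E G).injOn hss hg hs]

theorem eventually_curveProd_mem [Fintype ι] [FiniteDimensional ℝ E] [T2Space G]
    (φ : AutFlow E G) (h : ∀ i, HasGenerator (γ i) (X i)) {l : Filter ℝ} {L : List ι}
    (hX : ∀ i ∈ L, Tendsto (fun t => φ.differential t (X i)) l (𝓝 0)) {W : Set G}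
    (hW : W ∈ 𝓝 1) : ∀ᶠ t in l, ∀ s : ι → ℝ, ‖s‖ ≤ 1 → φ t (curveProd γ L s) ∈ W := by
  have : IsTopologicalGroup G := topologicalGroup_of_lieGroup 𝓘(ℝ, E) ∞
  induction L generalizing W with
  | nil =>
    refine .of_forall fun t s _ => ?_
    simpa [curveProd, φ.map_one] using mem_of_mem_nhds hW
  | cons i L ih =>
    obtain ⟨W', hW', hWW⟩ := exists_nhds_one_split hW
    obtain ⟨δ, hδ, hbound⟩ := exists_generator_bound (E := E) hW'
    filter_upwards [ih (fun j hj => hX j (List.mem_cons_of_mem _ hj)) hW',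
      (hX i List.mem_cons_self).norm.eventually_lt_const (by simpa using hδ)] with t ht hti s hs
    rw [curveProd_cons, φ.map_mul']
    exact hWW _ (hbound _ _ ((h i).comp_flow φ t) hti (s i) ((norm_le_pi_norm s i).trans hs))
      _ (ht s hs)

end SecondKind

/-! ### Contracted subgroups -/

namespace IsAutFlow

variable {K : Type*} [Group K] [TopologicalSpace K] [IsTopologicalGroup K] {φ : ℝ → K → K}
  {l : Filter ℝ} {g : K}

/-- The points that the flow contracts to `1` along the filter `l`. -/
def contractedSubgroup (hφ : IsAutFlow φ) (l : Filter ℝ) : Subgroup K where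
  carrier := {g | Tendsto (fun t => φ t g) l (𝓝 1)}
  mul_mem' {a b} ha hb := by
    simpa only [mem_ofPred, hφ.map_mul, mul_one] using
      Tendsto.mul (mem_ofPred.mp ha) (mem_ofPred.mp hb)
  one_mem' := by simpa only [mem_ofPred, hφ.map_one] using tendsto_const_nhds
  inv_mem' {a} ha := by
    simpa only [mem_ofPred, hφ.map_inv, inv_one] using Tendsto.inv (mem_ofPred.mp ha)

theorem mem_contractedSubgroup (hφ : IsAutFlow φ) :
    g ∈ hφ.contractedSubgroup l ↔ Tendsto (fun t => φ t g) l (𝓝 1) :=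
  Iff.rfl

theorem contractedSubgroup_reverse (hφ : IsAutFlow φ) :
    hφ.reverse.contractedSubgroup l = hφ.contractedSubgroup (map Neg.neg l) :=
  rfl

theorem map_mem_contractedSubgroup (hφ : IsAutFlow φ) {f : K → K} (hfc : Continuous f)
    (hf1 : f 1 = 1) (hf : ∀ t x, φ t (f x) = f (φ t x)) (hg : g ∈ hφ.contractedSubgroup l) :
    f g ∈ hφ.contractedSubgroup l := by
  rw [mem_contractedSubgroup] at hg ⊢
  simpa only [hf] using! (hfc.tendsto' 1 1 hf1).comp hg

end IsAutFlow

/-! ### The velocity of a flow of automorphisms -/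

namespace AutFlow

variable {E : Type*} [NormedAddCommGroup E] [NormedSpace ℝ E]
  {G : Type*} [TopologicalSpace G] [ChartedSpace E G] [Group G]

/-- The flow `t ↦ φ_{-t}`. -/
def reverse (φ : AutFlow E G) : AutFlow E G where
  toFun t := φ (-t)
  contMDiff' := φ.contMDiff'.comp
    ((contDiff_neg.contMDiff.comp contMDiff_fst).prodMk contMDiff_snd)
  map_mul' t := φ.map_mul' (-t)
  map_zero' x := by rw [neg_zero, φ.map_zero']
  map_add' s t x := by rw [neg_add, φ.map_add']

theorem displacement_zero (φ : AutFlow E G) (g : G) : φ 0 g * g⁻¹ = 1 := by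
  rw [φ.map_zero', mul_inv_cancel]

/-- The velocity at time `0` of the displacement `s ↦ φ_s(g) g⁻¹`, which starts at the identity. -/
def velocity (φ : AutFlow E G) (g : G) : E :=
  deriv (fun s => idChart E G (φ s g * g⁻¹)) 0

theorem velocity_one (φ : AutFlow E G) : φ.velocity 1 = 0 := by
  simp [velocity, φ.map_one]

theorem velocity_mul_of_fixed (φ : AutFlow E G) (g : G) {z : G} (hz : ∀ t, φ t z = z) :
    φ.velocity (g * z) = φ.velocity g := by
  simp only [velocity, φ.map_mul', hz, mul_inv_rev, mul_assoc, mul_inv_cancel_left]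

variable [LieGroup 𝓘(ℝ, E) ∞ G]

theorem contMDiff_displacement (φ : AutFlow E G) (g : G) :
    ContMDiff 𝓘(ℝ, ℝ) 𝓘(ℝ, E) ∞ (fun s => φ s g * g⁻¹) :=
  (φ.contMDiff_orbit g).mul contMDiff_const

theorem hasDerivAt_velocity (φ : AutFlow E G) (g : G) :
    HasDerivAt (fun s => idChart E G (φ s g * g⁻¹)) (φ.velocity g) 0 := by
  refine DifferentiableAt.hasDerivAt (ContDiffAt.differentiableAt (n := ∞)
    (contDiffAt_idChart_comp (φ.contMDiff_displacement g).contMDiffAt ?_) (by simp))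
  rw [displacement_zero]
  exact one_mem_idChart_source

theorem velocity_apply (φ : AutFlow E G) (t : ℝ) (g : G) :
    φ.velocity (φ t g) = φ.differential t (φ.velocity g) := by
  have hφ := φ.hasFDerivAt_idChart t
  rw [← φ.displacement_zero g] at hφ
  refine (φ.hasDerivAt_velocity (φ t g)).unique ((hφ.comp_hasDerivAt (0 : ℝ)
    (f := fun s => idChart E G (φ s g * g⁻¹)) (φ.hasDerivAt_velocity g)).congr_of_eventuallyEq ?_)
  filter_upwards [(φ.contMDiff_displacement g).continuous.continuousAt.eventually_mem
    (chart_source_mem_nhds E _)] with s hs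
  rw [displacement_zero] at hs
  simp only [Function.comp_apply, (idChart E G).left_inv hs]
  rw [φ.map_mul', φ.map_inv, ← φ.map_add', ← φ.map_add', add_comm]

theorem tendsto_velocity (φ : AutFlow E G) : Tendsto φ.velocity (𝓝 1) (𝓝 0) := by
  set F : ℝ × E → E := fun p => idChart E G
    (φ p.1 ((idChart E G).symm p.2) * ((idChart E G).symm p.2)⁻¹) with hF
  have hFd : ContDiffAt ℝ ∞ F (0, idChart E G 1) := φ.contDiffAt_displacement
  have hdiff : ∀ᶠ p in 𝓝 ((0 : ℝ), idChart E G 1), DifferentiableAt ℝ F p :=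
    (hFd.of_le (m := 1) ENat.LEInfty.out).eventually (by simp) |>.mono
      fun p hp => hp.differentiableAt (by simp)
  have hcoord : Tendsto (fun g : G => ((0 : ℝ), idChart E G g)) (𝓝 1) (𝓝 (0, idChart E G 1)) :=
    tendsto_const_nhds.prodMk_nhds ((idChart E G).continuousAt one_mem_idChart_source)
  have hvelocity : ∀ᶠ g in 𝓝 (1 : G), fderiv ℝ F (0, idChart E G g) (1, 0) = φ.velocity g := by
    filter_upwards [hcoord.eventually hdiff, chart_source_mem_nhds E (1 : G)] with g hg hgs
    refine (hg.hasFDerivAt.comp_hasDerivAt (0 : ℝ) (f := fun s : ℝ => (s, idChart E G g))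
      ((hasDerivAt_id (0 : ℝ)).prodMk (hasDerivAt_const _ _))).unique ?_
    simp only [hF, Function.comp_def, (idChart E G).left_inv hgs]
    exact φ.hasDerivAt_velocity g
  have hlim := (((hFd.fderiv_right (m := 0) (by simp)).continuousAt.clm_apply
    (continuousAt_const (y := ((1 : ℝ), (0 : E))))).tendsto.comp hcoord).congr' hvelocity
  rwa [hvelocity.self_of_nhds, velocity_one] at hlim

theorem hasMFDerivAt_orbit (φ : AutFlow E G) (g : G) (t : ℝ) :
    HasMFDerivAt 𝓘(ℝ, ℝ) 𝓘(ℝ, E) (fun s => φ s g) t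
      ((1 : ℝ →L[ℝ] ℝ).smulRight ((mfderiv 𝓘(ℝ, E) 𝓘(ℝ, E) (· * φ t g) (1 : G) : E →L[ℝ] E)
        (φ.velocity (φ t g))) : ℝ →L[ℝ] E) := by
  have hsub : HasMFDerivAt 𝓘(ℝ, ℝ) 𝓘(ℝ, ℝ) (fun s : ℝ => s - t) t (1 : ℝ →L[ℝ] ℝ) :=
    ((hasFDerivAt_id t).sub_const t).hasMFDerivAt
  have hdisp : HasMFDerivAt 𝓘(ℝ, ℝ) 𝓘(ℝ, E) (fun s => φ s (φ t g) * (φ t g)⁻¹) (t - t)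
      ((1 : ℝ →L[ℝ] ℝ).smulRight (φ.velocity (φ t g)) : ℝ →L[ℝ] E) := by
    rw [sub_self, hasMFDerivAt_iff_hasDerivAt (φ.displacement_zero _)]
    exact ⟨(φ.contMDiff_displacement _).continuous.continuousAt, φ.hasDerivAt_velocity _⟩
  have hmul : HasMFDerivAt 𝓘(ℝ, E) 𝓘(ℝ, E) (· * φ t g) (φ (t - t) (φ t g) * (φ t g)⁻¹)
      (mfderiv 𝓘(ℝ, E) 𝓘(ℝ, E) (· * φ t g) (1 : G) : E →L[ℝ] E) := by
    rw [sub_self, displacement_zero]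
    exact ((contMDiff_mul_right (n := ∞)).mdifferentiableAt (by simp)).hasMFDerivAt
  have hcomp := hmul.comp t (HasMFDerivAt.comp (f := fun s => s - t) t hdisp hsub)
  refine (hcomp.congr_of_eventuallyEq (.of_forall fun s => ?_)).congr_mfderiv
    (comp_one_smulRight (E := E) _ _)
  simp [← φ.map_add']

theorem apply_eq_self_of_velocity_eq_zero [T2Space G] (φ : AutFlow E G) {g : G}
    (h : ∀ t, φ.velocity (φ t g) = 0) (t : ℝ) : φ t g = g := by
  have : IsManifold 𝓘(ℝ, E) 1 G := IsManifold.of_le (n := ∞) ENat.LEInfty.out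
  have hzero (x : G) : mulInvariantVectorField (I := 𝓘(ℝ, E)) 0 x = 0 := map_zero _
  have horbit : IsMIntegralCurve (fun t => φ t g) (mulInvariantVectorField (I := 𝓘(ℝ, E)) 0) := by
    intro t
    have ht := φ.hasMFDerivAt_orbit g t
    rw [h] at ht
    exact ht.congr_mfderiv (congrArg (fun Y : E => (1 : ℝ →L[ℝ] ℝ).smulRight Y)
      ((map_zero _).trans (hzero _).symm))
  exact congrFun (isMIntegralCurve_Ioo_eq_of_contMDiff_boundaryless (t₀ := 0)
    (contMDiff_mulInvariantVectorField_one 0) horbit (isMIntegralCurve_const (hzero g))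
    (φ.map_zero' g)) t

end AutFlow

/-! ### The hyperbolic splitting of a Lie group -/

section Splitting

variable {E : Type*} [NormedAddCommGroup E] [NormedSpace ℝ E] [FiniteDimensional ℝ E]

theorem eq_zero_of_tendsto_atTop_atBot {ι : Type*} (b : Module.Basis ι ℝ E) {r : ι → ℝ}
    {A : ℝ → E →L[ℝ] E} (hA : ∀ i t, A t (b i) = Real.exp (r i * t) • b i) {v : E}
    (htop : Tendsto (fun t => A t v) atTop (𝓝 0)) (hbot : Tendsto (fun t => A t v) atBot (𝓝 0)) :
    v = 0 := by
  refine b.repr.map_eq_zero_iff.mp (Finsupp.ext fun i => ?_)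
  have hcoord (t : ℝ) : b.coord i (A t v) = Real.exp (r i * t) * b.coord i v := by
    refine LinearMap.congr_fun (f := b.coord i ∘ₗ (A t : E →ₗ[ℝ] E))
      (g := Real.exp (r i * t) • b.coord i) (b.ext fun j => ?_) v
    obtain rfl | hj := eq_or_ne j i
    · simp [hA]
    · simp [hA, hj]
  have hcont : Tendsto (b.coord i) (𝓝 0) (𝓝 0) :=
    (b.coord i).continuous_of_finiteDimensional.tendsto' 0 0 (map_zero _)
  -- The coordinates at the times `t` and `-t` have a product independent of `t`.
  have hprod (t : ℝ) : b.coord i (A t v) * b.coord i (A (-t) v) = b.coord i v * b.coord i v := by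
    rw [hcoord, hcoord, mul_mul_mul_comm, ← Real.exp_add, mul_neg, add_neg_cancel, Real.exp_zero,
      one_mul]
  have hlim := (hcont.comp htop).mul (hcont.comp (hbot.comp tendsto_neg_atTop_atBot))
  simp only [Function.comp_apply, hprod, mul_zero] at hlim
  exact mul_self_eq_zero.mp (tendsto_nhds_unique tendsto_const_nhds hlim)

theorem exists_sign_lists {ι : Type*} [Finite ι] (r : ι → ℝ) :
    ∃ P C N : List ι, (P ++ (C ++ N)).Nodup ∧ (∀ i, i ∈ P ++ (C ++ N)) ∧ (∀ i ∈ P, 0 < r i) ∧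
      (∀ i ∈ C, r i = 0) ∧ ∀ i ∈ N, r i < 0 := by
  classical
  cases nonempty_fintype ι
  have hnodup := Finset.nodup_toList (Finset.univ : Finset ι)
  refine ⟨Finset.univ.toList.filter fun i => 0 < r i, Finset.univ.toList.filter fun i => r i = 0,
    Finset.univ.toList.filter fun i => r i < 0, ?_, fun i => ?_, by simp, by simp, by simp⟩
  · refine (hnodup.filter _).append ((hnodup.filter _).append (hnodup.filter _) ?_) ?_
    · intro i hC hN
      simp only [List.mem_filter, decide_eq_true_eq] at hC hN
      exact hN.2.ne hC.2
    · intro i hP hCN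
      simp only [List.mem_append, List.mem_filter, decide_eq_true_eq] at hP hCN
      exact hCN.elim (fun hC => hP.2.ne' hC.2) fun hN => hP.2.not_gt hN.2
  · simpa using (lt_trichotomy (r i) 0).elim (by tauto) (by tauto)

variable {G : Type*} [TopologicalSpace G] [ChartedSpace E G] [Group G] [LieGroup 𝓘(ℝ, E) ∞ G]
  [T2Space G]

theorem AutFlow.eq_one_of_tendsto {ι : Type*} (φ : AutFlow E G) (b : Module.Basis ι ℝ E)
    {r : ι → ℝ} (hr : ∀ i t, φ.differential t (b i) = Real.exp (r i * t) • b i) {u z : G}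
    (hu : Tendsto (fun t => φ t u) atBot (𝓝 1)) (hz : ∀ t, φ t z = z)
    (huz : Tendsto (fun t => φ t (u * z)) atTop (𝓝 1)) : u * z = 1 := by
  have hv : φ.velocity u = 0 := by
    refine eq_zero_of_tendsto_atTop_atBot b hr ?_ ?_
    · simpa only [Function.comp_def, φ.velocity_apply, φ.velocity_mul_of_fixed u hz] using
        φ.tendsto_velocity.comp huz
    · simpa only [Function.comp_def, φ.velocity_apply] using φ.tendsto_velocity.comp hu
  have hfix : ∀ t, φ t (u * z) = u * z := φ.apply_eq_self_of_velocity_eq_zero fun t => by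
    rw [φ.velocity_apply, φ.velocity_mul_of_fixed u hz, hv, map_zero]
  simp only [hfix] at huz
  exact tendsto_nhds_unique tendsto_const_nhds huz

theorem HasGenerator.mem_contractedSubgroup [IsTopologicalGroup G] {φ : AutFlow E G}
    {γ : ℝ → G} {X : E} {l : Filter ℝ} (h : HasGenerator γ X)
    (hX : Tendsto (fun t => φ.differential t X) l (𝓝 0)) (s : ℝ) :
    γ s ∈ φ.isAutFlow.contractedSubgroup l := by
  refine φ.isAutFlow.mem_contractedSubgroup.mpr fun V hV => ?_
  obtain ⟨δ, hδ, hbound⟩ := exists_generator_bound (E := E) hV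
  have hsX : Tendsto (fun t => φ.differential t (s • X)) l (𝓝 0) := by
    simpa only [map_smul, smul_zero] using hX.const_smul s
  refine mem_map.mpr ?_
  filter_upwards [hsX.norm.eventually_lt_const (by simpa using hδ)] with t ht
  simpa using hbound _ _ ((h.comp_mul s).comp_flow φ t) ht 1 (by simp)

/-- One-parameter subgroups `γ_i` with generators `X_i`, for which the products over `P`, `C` and
`N` in this order fill a neighborhood of the identity: those in `P` are contracted by `ψ` in the
past, those in `C` lie in `Z`, and those in `N` are contracted by `φ` and `ψ` in the future. In the
application `ψ` is the hyperbolic part of `φ`. -/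
structure AdaptedCurves {ι : Type*} (φ ψ : AutFlow E G) (Z : Subgroup G) (γ : ι → ℝ → G)
    (X : ι → E) (P C N : List ι) : Prop where
  hasGenerator : ∀ i, HasGenerator (γ i) (X i)
  tendsto_atBot : ∀ i ∈ P, Tendsto (fun t => ψ.differential t (X i)) atBot (𝓝 0)
  mem_central : ∀ i ∈ C, ∀ s, γ i s ∈ Z
  tendsto_atTop : ∀ i ∈ N, Tendsto (fun t => ψ.differential t (X i)) atTop (𝓝 0)
  tendsto_atTop' : ∀ i ∈ N, Tendsto (fun t => φ.differential t (X i)) atTop (𝓝 0)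
  nhds_one_le : 𝓝 1 ≤ map (curveProd γ (P ++ (C ++ N))) (𝓝 0)

namespace AdaptedCurves

variable {ι : Type*} {φ ψ : AutFlow E G} {Z : Subgroup G} {γ : ι → ℝ → G} {X : ι → E}
  {P C N : List ι}

theorem eventually_mem [Fintype ι] (h : AdaptedCurves φ ψ Z γ X P C N) {W : Set G} (hW : W ∈ 𝓝 1) :
    ∀ᶠ t in atTop, ∀ s : ι → ℝ, ‖s‖ ≤ 1 → φ t (curveProd γ N s) ∈ W :=
  eventually_curveProd_mem φ h.hasGenerator h.tendsto_atTop' hW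

variable [IsTopologicalGroup G]

theorem curveProd_mem_unstable (h : AdaptedCurves φ ψ Z γ X P C N) (s : ι → ℝ) :
    curveProd γ P s ∈ ψ.isAutFlow.contractedSubgroup atBot :=
  curveProd_mem (fun i hi => (h.hasGenerator i).mem_contractedSubgroup (h.tendsto_atBot i hi)) s

theorem curveProd_mem_stable (h : AdaptedCurves φ ψ Z γ X P C N) (s : ι → ℝ) :
    curveProd γ N s ∈ ψ.isAutFlow.contractedSubgroup atTop :=
  curveProd_mem (fun i hi => (h.hasGenerator i).mem_contractedSubgroup (h.tendsto_atTop i hi)) s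

variable [Finite ι]

theorem tendsto_of_mem_contractedSubgroup (h : AdaptedCurves φ ψ Z γ X P C N)
    (hcomm : ∀ s t x, ψ s (φ t x) = φ t (ψ s x))
    (hdisj : ∀ u ∈ ψ.isAutFlow.contractedSubgroup atBot, ∀ z ∈ Z,
      u * z ∈ ψ.isAutFlow.contractedSubgroup atTop → u * z = 1)
    {g : G} (hg : g ∈ ψ.isAutFlow.contractedSubgroup atTop) :
    Tendsto (fun t => φ t g) atTop (𝓝 1) := by
  cases nonempty_fintype ι
  have hnhds : curveProd γ (P ++ (C ++ N)) '' Metric.closedBall 0 1 ∈ 𝓝 (1 : G) :=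
    h.nhds_one_le (image_mem_map (Metric.closedBall_mem_nhds _ one_pos))
  obtain ⟨T, s, hs, hT⟩ :=
    ((ψ.isAutFlow.mem_contractedSubgroup.mp hg).eventually_mem hnhds).exists
  rw [mem_closedBall_zero_iff] at hs
  rw [curveProd_append, curveProd_append, ← mul_assoc] at hT
  have hψg : ψ T g ∈ ψ.isAutFlow.contractedSubgroup atTop :=
    ψ.isAutFlow.map_mem_contractedSubgroup (ψ.isAutFlow.continuous_apply T) (ψ.map_one T)
      (fun t x => by rw [← ψ.map_add', ← ψ.map_add', add_comm]) hg
  have hone : curveProd γ P s * curveProd γ C s = 1 := by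
    refine hdisj _ (h.curveProd_mem_unstable s) _ (curveProd_mem h.mem_central s) ?_
    rw [eq_mul_inv_of_mul_eq hT]
    exact Subgroup.mul_mem _ hψg (Subgroup.inv_mem _ (h.curveProd_mem_stable s))
  rw [hone, one_mul] at hT
  have hlim : Tendsto (fun t => φ t (ψ T g)) atTop (𝓝 1) := fun W hW =>
    (h.eventually_mem hW).mono fun t ht => by simpa only [← hT] using ht s hs
  simpa only [Function.comp_def, hcomm, ψ.isAutFlow.neg_apply_apply] using
    ((ψ.isAutFlow.continuous_apply (-T)).tendsto' 1 1 (ψ.map_one _)).comp hlim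

theorem local_product (h : AdaptedCurves φ ψ Z γ X P C N) {V : Set G} (hV : V ∈ 𝓝 1) :
    ∃ K ⊆ (ψ.isAutFlow.contractedSubgroup atTop : Set G) ∩ V,
      (∀ W ∈ 𝓝 (1 : G), ∀ᶠ t in atTop, ∀ c ∈ K, φ t c ∈ W) ∧
      {x | ∃ u ∈ ψ.isAutFlow.contractedSubgroup atBot, ∃ z ∈ Z, z ∈ V ∧
        ∃ c ∈ K, x = u * z * c} ∈ 𝓝 (1 : G) := by
  cases nonempty_fintype ι
  refine ⟨curveProd γ N '' {s : ι → ℝ | ‖s‖ ≤ 1 ∧ curveProd γ N s ∈ V}, ?_, fun W hW => ?_, ?_⟩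
  · rintro _ ⟨s, hs, rfl⟩
    exact ⟨h.curveProd_mem_stable s, hs.2⟩
  · filter_upwards [h.eventually_mem hW] with t ht
    rintro _ ⟨s, hs, rfl⟩
    exact ht s hs.1
  · have hnear (L : List ι) : curveProd γ L ⁻¹' V ∈ 𝓝 (0 : ι → ℝ) :=
      (continuous_curveProd h.hasGenerator L).continuousAt.preimage_mem_nhds
        (by rwa [curveProd_zero h.hasGenerator])
    filter_upwards [h.nhds_one_le (image_mem_map (inter_mem
      (Metric.closedBall_mem_nhds (0 : ι → ℝ) one_pos) (inter_mem (hnear C) (hnear N))))]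
    rintro _ ⟨s, ⟨hs, hsC, hsN⟩, rfl⟩
    refine ⟨_, h.curveProd_mem_unstable s, _, curveProd_mem h.mem_central s, hsC, _,
      ⟨s, ⟨mem_closedBall_zero_iff.mp hs, hsN⟩, rfl⟩, ?_⟩
    rw [curveProd_append, curveProd_append, mul_assoc]

theorem hyperbolicSplitting (h : AdaptedCurves φ ψ Z γ X P C N)
    (hcomm : ∀ s t x, ψ s (φ t x) = φ t (ψ s x)) (hφZ : ∀ t, ∀ z ∈ Z, φ t z ∈ Z)
    (hψZ : ∀ z ∈ Z, ∀ t, ψ t z = z)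
    (hdisj : ∀ u ∈ ψ.isAutFlow.contractedSubgroup atBot, ∀ z ∈ Z,
      u * z ∈ ψ.isAutFlow.contractedSubgroup atTop → u * z = 1) :
    HyperbolicSplitting φ.toFun (ψ.isAutFlow.contractedSubgroup atTop) Z
      (ψ.isAutFlow.contractedSubgroup atBot) where
  flow := φ.isAutFlow
  map_central := hφZ
  map_unstable t x hx := ψ.isAutFlow.map_mem_contractedSubgroup
    (φ.isAutFlow.continuous_apply t) (φ.map_one t) (fun s x => hcomm s t x) hx
  conj_mem z hz u hu := ψ.isAutFlow.map_mem_contractedSubgroup (f := fun u => z * u * z⁻¹)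
    (by fun_prop) (by simp) (fun t x => by rw [ψ.map_mul', ψ.map_mul', ψ.map_inv, hψZ z hz t]) hu
  eq_one_of_mem_stable := hdisj
  eq_one_of_mem_central u hu hu' := by
    rw [IsAutFlow.mem_contractedSubgroup] at hu
    simp only [hψZ u hu'] at hu
    exact tendsto_nhds_unique tendsto_const_nhds hu
  tendsto_stable _ hs := h.tendsto_of_mem_contractedSubgroup hcomm hdisj hs
  local_product _ hV := h.local_product hV

end AdaptedCurves

theorem AutFlow.hyperbolicSplitting_of_eigenbasis [IsTopologicalGroup G] {ι : Type*} [Finite ι]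
    {φ ψ : AutFlow E G} {Z : Subgroup G} (hcomm : ∀ s t x, ψ s (φ t x) = φ t (ψ s x))
    (hφZ : ∀ t, ∀ z ∈ Z, φ t z ∈ Z) (hψZ : ∀ z ∈ Z, ∀ t, ψ t z = z) (b : Module.Basis ι ℝ E)
    {r : ι → ℝ} (hr : ∀ i t, ψ.differential t (b i) = Real.exp (r i * t) • b i)
    (hcentral : ∀ i, r i = 0 → ∀ γ : ℝ → G, HasGenerator γ (b i) → ∀ s, γ s ∈ Z)
    (hstable : ∀ i, r i < 0 → Tendsto (fun t => φ.differential t (b i)) atTop (𝓝 0)) :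
    HyperbolicSplitting φ.toFun (ψ.isAutFlow.contractedSubgroup atTop) Z
      (ψ.isAutFlow.contractedSubgroup atBot) := by
  choose γ hγ using fun i => exists_hasGenerator (G := G) (b i)
  obtain ⟨P, C, N, hnodup, hmem, hP, hC, hN⟩ := exists_sign_lists r
  have hψ {l : Filter ℝ} {i : ι} (hl : Tendsto (fun t => r i * t) l atBot) :
      Tendsto (fun t => ψ.differential t (b i)) l (𝓝 0) := by
    simpa only [hr, zero_smul] using! (Real.tendsto_exp_atBot.comp hl).smul_const (b i)
  have hcurves : AdaptedCurves φ ψ Z γ b P C N :=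
    { hasGenerator := hγ
      tendsto_atBot := fun i hi => hψ (tendsto_id.const_mul_atBot (hP i hi))
      mem_central := fun i hi => hcentral i (hC i hi) _ (hγ i)
      tendsto_atTop := fun i hi => hψ (tendsto_id.const_mul_atTop_of_neg (hN i hi))
      tendsto_atTop' := fun i hi => hstable i (hN i hi)
      nhds_one_le := nhds_one_le_map_curveProd b hγ hnodup hmem }
  exact hcurves.hyperbolicSplitting hcomm hφZ hψZ fun u hu z hz huz =>
    ψ.eq_one_of_tendsto b hr hu (hψZ z hz) huz

end Splitting

/-! ### The Jordan decomposition of a flow of automorphisms -/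

theorem IsHyperbolic.exists_eigenbasis {V : Type*} [AddCommGroup V] [Module ℝ V]
    [FiniteDimensional ℝ V] {D : Module.End ℝ V} (hD : IsHyperbolic D) :
    ∃ (n : ℕ) (b : Module.Basis (Fin n) ℝ V) (r : Fin n → ℝ), ∀ i, D (b i) = r i • b i := by
  have hspan : ⊤ ≤ Submodule.span ℝ {X : V | ∃ r : ℝ, D X = r • X} := by
    rw [← hD.iSup_eigenspace_eq_top]
    exact iSup_le fun r X hX => Submodule.subset_span ⟨r, Module.End.mem_eigenspace_iff.mp hX⟩
  let b := Module.Basis.ofSpan hspan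
  have : Fintype _ := FiniteDimensional.fintypeBasisIndex b
  have hb : ∀ i, ∃ r : ℝ, D (b i) = r • b i := fun i =>
    Module.Basis.ofSpan_subset hspan ⟨i, rfl⟩
  choose r hr using hb
  exact ⟨_, b.reindex (Fintype.equivFin _), fun i => r ((Fintype.equivFin _).symm i),
    fun i => by simpa using hr _⟩

namespace AutFlow

variable {E : Type*} [NormedAddCommGroup E] [NormedSpace ℝ E]
  {G : Type*} [TopologicalSpace G] [ChartedSpace E G] [Group G]

/-- The vectors that the differential contracts to `0` along the filter `l`: the infinitesimal
counterpart of `IsAutFlow.contractedSubgroup`. -/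
def contractedSubspace (ψ : AutFlow E G) (l : Filter ℝ) : Submodule ℝ E where
  carrier := {X | Tendsto (fun t => ψ.differential t X) l (𝓝 0)}
  add_mem' hX hY := by
    simpa only [mem_ofPred, map_add, add_zero] using Tendsto.add (mem_ofPred.mp hX) hY
  zero_mem' := by simpa only [mem_ofPred, map_zero] using tendsto_const_nhds
  smul_mem' c X hX := by
    simpa only [mem_ofPred, map_smul, smul_zero] using Tendsto.const_smul (mem_ofPred.mp hX) c

variable [FiniteDimensional ℝ E] {φ φH φE φN : AutFlow E G}

theorem IsJordanDecomposition.commute (hJ : IsJordanDecomposition φ φH φE φN) (s t : ℝ) (x : G) :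
    φH s (φ t x) = φ t (φH s x) := by
  rw [hJ.eq_comp, hJ.eq_comp, ← hJ.commute_HN, ← hJ.commute_HE, ← φH.map_add', ← φH.map_add',
    add_comm]

theorem IsJordanDecomposition.differential_eq (hJ : IsJordanDecomposition φ φH φE φN) (t : ℝ) :
    φ.differential t = φE.differential t * (φN.differential t * φH.differential t) := by
  have hcomp := φE.hasMFDerivAt_comp t (φN.hasMFDerivAt_comp t (φH.hasMFDerivAt t) (φH.map_one t))
    (by simp only [Function.comp_apply, map_one])
  rw [← (funext fun x => by rw [hJ.eq_comp, hJ.commute_HE, hJ.commute_HN]; rfl :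
    φ.toFun t = φE.toFun t ∘ φN.toFun t ∘ φH.toFun t)] at hcomp
  exact hasMFDerivAt_unique (φ.hasMFDerivAt t) hcomp

variable [LieGroup 𝓘(ℝ, E) ∞ G]

theorem connectedSubgroup_le_contractedSubgroup [T2Space G] [IsTopologicalGroup G]
    (ψ : AutFlow E G) {l : Filter ℝ} {h : Submodule ℝ (GroupLieAlgebra 𝓘(ℝ, E) G)}
    (hl : h ≤ ψ.contractedSubspace l) :
    connectedSubgroup (E := E) h ≤ ψ.isAutFlow.contractedSubgroup l := by
  refine (Subgroup.closure_le _).mpr ?_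
  rintro _ ⟨X, hX, γ, hγ, rfl⟩
  exact hγ.hasGenerator.mem_contractedSubgroup (hl hX) 1

namespace IsJordanDecomposition

theorem differential_eigenvector (hJ : IsJordanDecomposition φ φH φE φN) {X : E} {r : ℝ}
    (hX : ((jordanParts φ.derivation).1 : E →ₗ[ℝ] E) X = r • X) (t : ℝ) :
    φH.differential t X = Real.exp (r * t) • X := by
  rw [← hJ.derivation_H] at hX
  exact φH.isLinearFlow_differential.apply_eigenvector hX t

theorem tendsto_differential (hJ : IsJordanDecomposition φ φH φE φN) {X : E} {r : ℝ}
    (hX : ((jordanParts φ.derivation).1 : E →ₗ[ℝ] E) X = r • X)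
    {l : Filter ℝ} (hl : Tendsto (fun t => r * t) l atBot) :
    Tendsto (fun t => φ.differential t X) l (𝓝 0) := by
  have hE : IsElliptic φE.derivation :=
    hJ.derivation_E ▸ (jordanParts_spec φ.derivation).elliptic
  have hN : IsNilpotent φN.derivation :=
    hJ.derivation_N ▸ (jordanParts_spec φ.derivation).nilpotent
  simpa only [hJ.differential_eq, mul_apply_eq_comp, hJ.differential_eigenvector hX, map_smul] using
    φE.isLinearFlow_differential.tendsto_exp_smul_of_isElliptic_of_isNilpotent hE
      φN.isLinearFlow_differential hN hl X

theorem eigenspace_le (hJ : IsJordanDecomposition φ φH φE φN) {r : ℝ} {l : Filter ℝ}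
    (hl : Tendsto (fun t => r * t) l atBot) :
    Module.End.eigenspace (jordanParts φ.derivation).1 r ≤ φH.contractedSubspace l := by
  intro X hX
  have hlim := (Real.tendsto_exp_atBot.comp hl).smul_const (X : E)
  rw [zero_smul] at hlim
  exact hlim.congr fun t =>
    (hJ.differential_eigenvector (Module.End.mem_eigenspace_iff.mp hX) t).symm

theorem mem_centralSubgroup [T2Space G] {X : E}
    (hX : ((jordanParts φ.derivation).1 : E →ₗ[ℝ] E) X = (0 : ℝ) • X)
    {γ : ℝ → G} (hγ : HasGenerator γ X) (s : ℝ) : γ s ∈ φ.centralSubgroup := by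
  intro φH φE φN hJ t
  have hfix : φH.differential t X = X := by
    rw [hJ.differential_eigenvector hX, zero_mul, Real.exp_zero, one_smul]
  have hcomp := hγ.comp_flow φH t
  rw [hfix] at hcomp
  exact congrFun (hcomp.unique hγ) s

variable [T2Space G] [IsTopologicalGroup G]

theorem stableSubgroup_le (hJ : IsJordanDecomposition φ φH φE φN) :
    φ.stableSubgroup ≤ φH.isAutFlow.contractedSubgroup atTop :=
  φH.connectedSubgroup_le_contractedSubgroup <|
    iSup₂_le fun _ hr => hJ.eigenspace_le (tendsto_id.const_mul_atTop_of_neg hr)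

theorem unstableSubgroup_le (hJ : IsJordanDecomposition φ φH φE φN) :
    φ.unstableSubgroup ≤ φH.isAutFlow.contractedSubgroup atBot :=
  φH.connectedSubgroup_le_contractedSubgroup <|
    iSup₂_le fun _ hr => hJ.eigenspace_le (tendsto_id.const_mul_atBot hr)

theorem hyperbolicSplitting (hJ : IsJordanDecomposition φ φH φE φN) :
    HyperbolicSplitting φ.toFun (φH.isAutFlow.contractedSubgroup atTop) φ.centralSubgroup
      (φH.isAutFlow.contractedSubgroup atBot) := by
  obtain ⟨n, b, r, hr⟩ : ∃ (n : ℕ) (b : Module.Basis (Fin n) ℝ E) (r : Fin n → ℝ),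
      ∀ i, ((jordanParts φ.derivation).1 : E →ₗ[ℝ] E) (b i) = r i • b i :=
    (jordanParts_spec φ.derivation).hyperbolic.exists_eigenbasis
  exact AutFlow.hyperbolicSplitting_of_eigenbasis hJ.commute
    (fun t z hz => φ.map_mem_centralSubgroup t hz) (fun z hz => hz φH φE φN hJ) b
    (fun i => hJ.differential_eigenvector (hr i))
    (fun i hi γ hγ => mem_centralSubgroup (hi ▸ hr i) hγ)
    (fun i hi => hJ.tendsto_differential (hr i) (tendsto_id.const_mul_atTop_of_neg hi))

theorem hyperbolicSplitting_reverse (hJ : IsJordanDecomposition φ φH φE φN) :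
    HyperbolicSplitting (fun t => φ (-t)) (φH.isAutFlow.contractedSubgroup atBot)
      φ.centralSubgroup (φH.isAutFlow.contractedSubgroup atTop) := by
  obtain ⟨n, b, r, hr⟩ : ∃ (n : ℕ) (b : Module.Basis (Fin n) ℝ E) (r : Fin n → ℝ),
      ∀ i, ((jordanParts φ.derivation).1 : E →ₗ[ℝ] E) (b i) = r i • b i :=
    (jordanParts_spec φ.derivation).hyperbolic.exists_eigenbasis
  have h := AutFlow.hyperbolicSplitting_of_eigenbasis (φ := φ.reverse) (ψ := φH.reverse)
    (fun s t => hJ.commute (-s) (-t)) (fun t z hz => φ.map_mem_centralSubgroup (-t) hz)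
    (fun z hz t => hz φH φE φN hJ (-t)) b (r := fun i => -r i)
    (fun i t => (hJ.differential_eigenvector (hr i) (-t)).trans (by rw [neg_mul_comm]))
    (fun i hi γ hγ => mem_centralSubgroup (neg_eq_zero.mp hi ▸ hr i) hγ)
    (fun i hi => (hJ.tendsto_differential (hr i)
      (tendsto_id.const_mul_atBot (neg_lt_zero.mp hi))).comp tendsto_neg_atTop_atBot)
  have hunstable := φH.isAutFlow.contractedSubgroup_reverse (l := atTop)
  have hstable := φH.isAutFlow.contractedSubgroup_reverse (l := atBot)
  rw [map_neg_atTop] at hunstable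
  rw [map_neg_atBot] at hstable
  rw [← hunstable, ← hstable]
  exact h

end IsJordanDecomposition

end AutFlow

end ChainRec

end

theorem theorem3p5_general {E : Type*} [NormedAddCommGroup E] [NormedSpace ℝ E]
    [FiniteDimensional ℝ E] {G : Type*} [TopologicalSpace G] [ChartedSpace E G] [Group G]
    [LieGroup 𝓘(ℝ, E) ∞ G] [T2Space G] (φ : ChainRec.AutFlow E G) :
    ChainRec.chainRecurrentSet φ ∩
        (((φ.unstableSubgroup : Set G) * (φ.centralSubgroup : Set G)) *
          (φ.stableSubgroup : Set G)) =
      (Subtype.val '' ChainRec.chainRecurrentSet φ.restrictCentral : Set G) := by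
  have : IsTopologicalGroup G := topologicalGroup_of_lieGroup 𝓘(ℝ, E) ∞
  refine Set.Subset.antisymm ?_ ?_
  · rintro x ⟨hx, hx'⟩
    by_cases hJ : ∃ φH φE φN, ChainRec.AutFlow.IsJordanDecomposition φ φH φE φN
    · obtain ⟨φH, φE, φN, hJ⟩ := hJ
      exact hJ.hyperbolicSplitting.chainRecurrentSet_inter_subset hJ.hyperbolicSplitting_reverse
        ⟨hx, Set.mul_subset_mul (Set.mul_subset_mul_right hJ.unstableSubgroup_le)
          hJ.stableSubgroup_le hx'⟩
    · -- Without a decomposition to test against, the central subgroup is the whole group.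
      have hcentral (g : G) : g ∈ φ.centralSubgroup := fun φH φE φN h => absurd ⟨φH, φE, φN, h⟩ hJ
      exact ⟨⟨x, hcentral x⟩, ChainRec.map_mem_chainRecurrentSet
        ((MonoidHom.id G).codRestrict φ.centralSubgroup hcentral)
        (continuous_id.subtype_mk hcentral) (fun _ _ => rfl) hx, rfl⟩
  · rintro _ ⟨z, hz, rfl⟩
    exact ⟨ChainRec.map_mem_chainRecurrentSet φ.centralSubgroup.subtype continuous_subtype_val
        (fun _ _ => rfl) hz,
      z, ⟨1, Subgroup.one_mem _, z, z.2, one_mul _⟩, 1, Subgroup.one_mem _, mul_one _⟩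

theorem theorem3p5 {E : Type*} [NormedAddCommGroup E] [NormedSpace ℝ E] [FiniteDimensional ℝ E]
    {G : Type*} [TopologicalSpace G] [ChartedSpace E G] [Group G]
    [LieGroup 𝓘(ℝ, E) ∞ G] [T2Space G] [ConnectedSpace G] (φ : ChainRec.AutFlow E G) :
    ChainRec.chainRecurrentSet φ ∩
        (((φ.unstableSubgroup : Set G) * (φ.centralSubgroup : Set G)) * (φ.stableSubgroup : Set G)) =
      (Subtype.val '' ChainRec.chainRecurrentSet φ.restrictCentral : Set G) :=
  theorem3p5_general φ
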